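/- Work in the language of rings $(+,\cdot,-,0,1)$. A field $K$ is \emph{Hilbertian} if for all $r\ge 1$, all polynomials $f_1,\dots,f_m\in K[T_1,\dots,T_r][X]$ that are irreducible in $K(T_1,\dots,T_r)[X]$ and separable in $X$, and every nonzero $g\in K[T_1,\dots,T_r]$, there is $a\in K^r$ such that $g(a)\neq 0$ and all $f_i(a,X)$ are irreducible in $K[X]$. A \emph{$\forall^1\exists^1$ sentence} is a sentence logically equivalent to one of the form $\forall x\,\exists y\,\psi(x,y)$ with $\psi$ quantifier-free, and the \emph{$\forall^1\exists^1$ theory} of a class of fields is the set of all $\forall^1\exists^1$ sentences that are true in every field of the class. \textbf{Theorem.} The $\forall^1\exists^1$ theory of Hilbertian fields is decidable: there is an algorithm which decides, given a sentence of the form $\forall x\,\exists y\,\psi(x,y)$ with $\psi$ quantifier-free, whether it is true in all Hilbertian fields (that is, the set of Gödel numbers of the sentences of this form belonging to the theory is recursive). Moreover, the $\forall^1\exists^1$ theory of Hilbertian fields is equal to the $\forall^1\exists^1$ theory of infinite fields. -/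

import Mathlib

universe u

namespace HilbertianDecidability

open FirstOrder

/-! ### Hilbertian fields -/

/-- The Hilbert subset of `K ^ r` attached to polynomials `f₁, …, fₘ ∈ K[T₁, …, Tᵣ][X]` and
`g ∈ K[T₁, …, Tᵣ]`: the points `a` at which `g` does not vanish and all the specialized
polynomials `fᵢ(a, X)` are irreducible in `K[X]`. -/
def hilbertSet {K : Type u} [Field K] {r m : ℕ}
    (f : Fin m → Polynomial (MvPolynomial (Fin r) K)) (g : MvPolynomial (Fin r) K) :
    Set (Fin r → K) :=
  {a | MvPolynomial.eval a g ≠ 0 ∧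
    ∀ i, Irreducible ((f i).map (MvPolynomial.eval a))}

/-- A field `K` is Hilbertian if all its separable Hilbert sets are non-empty: for `r ≥ 1`,
`f₁, …, fₘ` irreducible in `K(T₁, …, Tᵣ)[X]` and separable in `X`, and `g ≠ 0`, the
corresponding Hilbert set is non-empty. Here the `fᵢ` have coefficients in `K[T₁, …, Tᵣ]`;
this is no restriction, as the denominators of coefficients in `K(T₁, …, Tᵣ)` can be cleared and
multiplied into `g`. -/
def IsHilbertian (K : Type u) [Field K] : Prop :=
  ∀ (r : ℕ), 0 < r → ∀ (m : ℕ) (f : Fin m → Polynomial (MvPolynomial (Fin r) K))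
    (g : MvPolynomial (Fin r) K),
    (∀ i, Irreducible
      ((f i).map (algebraMap (MvPolynomial (Fin r) K) (FractionRing (MvPolynomial (Fin r) K))))) →
    (∀ i, Polynomial.Separable
      ((f i).map (algebraMap (MvPolynomial (Fin r) K) (FractionRing (MvPolynomial (Fin r) K))))) →
    g ≠ 0 → (hilbertSet f g).Nonempty

/-! ### `∀¹∃¹` sentences and theories in the language of rings -/

/-- Truth in a field `K` of a sentence of the language of rings `(+, *, -, 0, 1)`. -/
def Holds (K : Type u) [Field K] (φ : Language.ring.Sentence) : Prop :=
  letI := Ring.compatibleRingOfRing K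
  Language.Sentence.Realize K φ

/-- `φ` is literally of the form `∀ x ∃ y, ψ(x, y)` with `ψ` quantifier-free. -/
def IsForallExistsForm (φ : Language.ring.Sentence) : Prop :=
  ∃ ψ : Language.ring.BoundedFormula Empty 2, ψ.IsQF ∧ φ = ψ.ex.all

/-- `φ` is a `∀¹∃¹` sentence: it is logically equivalent to one of the form `∀ x ∃ y, ψ(x, y)`
with `ψ` quantifier-free. -/
def IsForallExists (φ : Language.ring.Sentence) : Prop :=
  ∃ χ : Language.ring.Sentence,
    IsForallExistsForm χ ∧ Language.Theory.Iff (∅ : Language.ring.Theory) φ χ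

/-- The `∀¹∃¹` theory of a class `C` of fields: all `∀¹∃¹` sentences true in every member. -/
def forallExistsTheory (C : ∀ (K : Type u) [Field K], Prop) : Set Language.ring.Sentence :=
  {φ | IsForallExists φ ∧ ∀ (K : Type u) [Field K], C K → Holds K φ}

/-! ### Gödel numbers and decidability -/

/-- Gödel numbers of terms of the language of rings in the variables `x₀, …, xₙ₋₁`. -/
def termCode {n : ℕ} : Language.ring.Term (Empty ⊕ Fin n) → ℕ
  | .var (.inl e) => e.elim
  | .var (.inr i) => Nat.pair 0 i
  | .func ringFunc.zero _ => Nat.pair 1 0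
  | .func ringFunc.one _ => Nat.pair 1 1
  | .func ringFunc.neg ts => Nat.pair 2 (termCode (ts 0))
  | .func ringFunc.add ts => Nat.pair 3 (Nat.pair (termCode (ts 0)) (termCode (ts 1)))
  | .func ringFunc.mul ts => Nat.pair 4 (Nat.pair (termCode (ts 0)) (termCode (ts 1)))

/-- Gödel numbers of formulas of the language of rings; the variables are
`x₀, …, xₙ₋₁`, and `∀` binds the last one. -/
def formulaCode : {n : ℕ} → Language.ring.BoundedFormula Empty n → ℕ
  | _, .falsum => Nat.pair 0 0
  | _, .equal t s => Nat.pair 1 (Nat.pair (termCode t) (termCode s))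
  | _, .rel R _ => Empty.elim R
  | _, .imp φ ψ => Nat.pair 2 (Nat.pair (formulaCode φ) (formulaCode ψ))
  | _, .all φ => Nat.pair 3 (formulaCode φ)

/-- Distinct terms have distinct Gödel numbers. -/
theorem termCode_injective {n : ℕ} :
    Function.Injective (termCode : Language.ring.Term (Empty ⊕ Fin n) → ℕ) := by
  intro t
  induction t with
  | var v =>
    intro s h
    rcases v with e | i
    · exact e.elim
    rcases s with (e | j) | ⟨f, us⟩
    · exact e.elim
    · simp only [termCode, Nat.pair_eq_pair, true_and] at h
      rw [Fin.ext h]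
    · cases f <;> simp [termCode, Nat.pair_eq_pair] at h
  | func f ts ih =>
    intro s h
    rcases s with (e | j) | ⟨g, us⟩
    · exact e.elim
    · cases f <;> simp [termCode, Nat.pair_eq_pair] at h
    · cases f <;> cases g <;> simp [termCode, Nat.pair_eq_pair] at h <;>
        congr 1 <;> funext i
      · fin_cases i
        · exact ih 0 h.1
        · exact ih 1 h.2
      · fin_cases i
        · exact ih 0 h.1
        · exact ih 1 h.2
      · fin_cases i
        exact ih 0 h
      · exact i.elim0
      · exact i.elim0

/-- Distinct formulas have distinct Gödel numbers. -/
theorem formulaCode_injective {n : ℕ} :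
    Function.Injective (formulaCode : Language.ring.BoundedFormula Empty n → ℕ) := by
  intro φ
  induction φ with
  | falsum =>
    intro χ h
    cases χ with
    | rel R _ => exact Empty.elim R
    | falsum => rfl
    | _ => simp [formulaCode, Nat.pair_eq_pair] at h
  | equal t s =>
    intro χ h
    cases χ with
    | rel R _ => exact Empty.elim R
    | equal t' s' =>
      simp only [formulaCode, Nat.pair_eq_pair, true_and] at h
      rw [termCode_injective h.1, termCode_injective h.2]
    | _ => simp [formulaCode, Nat.pair_eq_pair] at h
  | rel R _ => exact Empty.elim R
  | imp φ ψ ih₁ ih₂ =>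
    intro χ h
    cases χ with
    | rel R _ => exact Empty.elim R
    | imp φ' ψ' =>
      simp only [formulaCode, Nat.pair_eq_pair, true_and] at h
      rw [ih₁ h.1, ih₂ h.2]
    | _ => simp [formulaCode, Nat.pair_eq_pair] at h
  | all φ ih =>
    intro χ h
    cases χ with
    | rel R _ => exact Empty.elim R
    | all φ' =>
      simp only [formulaCode, Nat.pair_eq_pair, true_and] at h
      rw [ih h]
    | _ => simp [formulaCode, Nat.pair_eq_pair] at h

/-- Decidability of a set `T` of `∀¹∃¹` sentences, the instances of the decision problem being
the sentences `∀ x ∃ y, ψ(x, y)` with `ψ` quantifier-free: the set of Gödel numbers of the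
sentences of this form in `T` is recursive. -/
def ForallExistsDecidable (T : Set Language.ring.Sentence) : Prop :=
  ComputablePred fun k : ℕ =>
    ∃ φ : Language.ring.Sentence, IsForallExistsForm φ ∧ formulaCode φ = k ∧ φ ∈ T

end HilbertianDecidability

/-!
# Decidability of the `∀¹∃¹` theory of Hilbertian fields

Hilbertian fields are infinite. Conversely, for an infinite field `K` the field `K(t₀, t₁, …)` is
Hilbertian: the data of a Hilbert set only involve finitely many of the `tᵢ`, and some of the others
can be substituted for the variables (`isHilbertian_ratFuncNat`). If `∀ x ∃ y, ψ(x, y)` holds in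
`K(t₀, t₁, …)` and `a` is in `K`, then either there is a solution `y` in `K`, or there is one
transcendental over `K`, and then all but finitely many elements of `K` are solutions
(`Clause.Holds.ratFuncNat`, `SolvableGen.solvable`). So both theories agree.

The same argument shows that a sentence is true in all infinite fields if and only if, for every
field `k`, finite ones included, and every `a` in `k`, there is a solution in `k` or a generic one.
By Post's theorem it suffices to give finite certificates both for truth and for falsity.

*Truth.* It is enough to look at fields `k` generated by `a`, that is, at the residue fields of the
points of the spectrum of `ℤ[X]`. A solution at such a point is a fraction in `a`, which is a
solution on a constructible set. By Noetherian induction finitely many of these sets, and those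
where generic solutions exist, cover the spectrum (`exists_finite_cover`), and by the
Nullstellensatz the covering property is expressed by finitely many ideal memberships
(`exists_pow_mem_span_of_cover`).

*Falsity.* A counterexample is a field `k` generated by an element `a`, given by its characteristic
and either the minimal polynomial of `a`, which may be assumed to be integral after multiplication
by an integer, or the information that `a` is transcendental. Generic solutions are visible from the
coefficients. Any other solution `y` in `k` is a root of a nonzero polynomial with coefficients in
`ℤ[a]`, and is a fraction in `a` with numerator and denominator from an explicit finite set
(`PointCheck.goodPoint`), so that solvability can be checked. This is trivial if `k` is finite. In
`ℚ(X)` and `𝔽ₚ(X)` it is the rational root theorem together with the bounds on coefficients of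
factors that come from the Mahler measure; in a number field one writes `y` times the leading
coefficient of its equation and the derivative of the minimal polynomial as a polynomial in `a`, with
coefficients that are traces, and bounds these at the complex places
(`isBoxFraction_of_root_numberField`).

Both kinds of certificates can be checked by primitive recursive functions on codes for integer
polynomials (`CompRing`).
-/

namespace HilbertianDecidability

open FirstOrder

/-! ### A Hilbertian field of rational functions in infinitely many variables -/

/-- The bijection `Fin r ⊕ ℕ ≃ ℕ` that inserts the block `Fin r` at the positions
`N, …, N + r - 1`; the numbers below `N` stay in place. -/
def insertBlock (r N : ℕ) : Fin r ⊕ ℕ ≃ ℕ where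
  toFun := Sum.elim (fun j => N + j) (fun i => if i < N then i else i + r)
  invFun n := if n < N then .inr n else if h : n - N < r then .inl ⟨n - N, h⟩ else .inr (n - r)
  left_inv := by
    rintro (j | i)
    · simp
    · by_cases h : i < N
      · simp [h]
      · have h1 : ¬ i + r < N := by omega
        have h2 : ¬ i + r - N < r := by omega
        simp [h, h1, h2]
  right_inv n := by
    by_cases h : n < N
    · simp [h]
    · by_cases h' : n - N < r
      · simp [h, h']; omega
      · have h1 : ¬ n - r < N := by omega
        simp only [h, h', if_false, dif_neg, not_false_iff, Sum.elim_inr, h1]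
        omega

section Hilbertian

open MvPolynomial

attribute [local instance] MvPolynomial.algebraMvPolynomial

variable (K : Type u) [Field K] (r N : ℕ)

/-- Polynomials in `T₁, …, Tᵣ` over `K[t₀, t₁, …]` are polynomials in `t₀, t₁, …`: the `Tⱼ` become
the variables `t_N, …, t_{N+r-1}`, and `t_N, t_{N+1}, …` move up to make room. -/
noncomputable def insertVars :
    MvPolynomial (Fin r) (MvPolynomial ℕ K) ≃+* MvPolynomial ℕ K :=
  (sumRingEquiv K (Fin r) ℕ).symm.trans (renameEquiv K (insertBlock r N)).toRingEquiv

lemma insertVars_X (j : Fin r) : insertVars K r N (X j) = X (N + j) := by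
  simp [insertVars, insertBlock]

lemma insertVars_C (b : MvPolynomial ℕ K) :
    insertVars K r N (C b) = rename (insertBlock r N ∘ Sum.inr) b := by
  induction b using MvPolynomial.induction_on with
  | C a => simp [insertVars]
  | add p q hp hq => simp only [map_add, hp, hq]
  | mul_X p n hp =>
    rw [C_mul, map_mul, map_mul, hp]
    simp [insertVars]

/-- The field `K(t₀, t₁, …)`. -/
abbrev RatFuncNat := FractionRing (MvPolynomial ℕ K)

/-- The endomorphism of `K(t₀, t₁, …)` that moves the variables `t_N, t_{N+1}, …` up by `r`. -/
noncomputable def shiftVars : RatFuncNat K →+* RatFuncNat K :=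
  IsFractionRing.map (A := MvPolynomial ℕ K) (B := MvPolynomial ℕ K)
    (j := (rename (R := K) (insertBlock r N ∘ Sum.inr)).toRingHom)
    (rename_injective _ ((insertBlock r N).injective.comp Sum.inr_injective))

lemma shiftVars_algebraMap (b : MvPolynomial ℕ K) :
    shiftVars K r N (algebraMap _ _ b) =
      algebraMap _ _ (rename (insertBlock r N ∘ Sum.inr) b) := by
  simp [shiftVars, IsFractionRing.map]

variable {K}

/-- Every rational function involves finitely many variables only. -/
lemma exists_shiftVars_eq (c : RatFuncNat K) : ∃ N₀, ∀ N ≥ N₀, shiftVars K r N c = c := by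
  have key : ∀ b : MvPolynomial ℕ K, ∃ N₀, ∀ N ≥ N₀,
      rename (insertBlock r N ∘ Sum.inr) b = b := by
    intro b
    refine ⟨b.vars.sup id + 1, fun N hN => ?_⟩
    have h1 : rename (insertBlock r N ∘ Sum.inr) b = rename id b := by
      rw [rename_eq_aeval, rename_eq_aeval]
      refine eval₂Hom_congr' rfl ?_ rfl
      intro i hi _
      have : i ≤ b.vars.sup id := Finset.le_sup (f := id) hi
      have h2 : i < N := by omega
      simp [insertBlock, h2]
    rw [h1, rename_id_apply]
  obtain ⟨p, q, hq, rfl⟩ := IsFractionRing.div_surjective (A := MvPolynomial ℕ K) c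
  obtain ⟨N₁, h₁⟩ := key p
  obtain ⟨N₂, h₂⟩ := key q
  refine ⟨max N₁ N₂, fun N hN => ?_⟩
  rw [map_div₀, shiftVars_algebraMap, shiftVars_algebraMap, h₁ N (le_of_max_le_left hN),
    h₂ N (le_of_max_le_right hN)]

variable (K)

/-- The specialization `Tⱼ ↦ t_{N+j}` on polynomials over `K(t₀, t₁, …)`, combined with
`shiftVars` on the coefficients. -/
noncomputable def freshHom : MvPolynomial (Fin r) (RatFuncNat K) →+* RatFuncNat K :=
  eval₂Hom (shiftVars K r N) (fun j => algebraMap (MvPolynomial ℕ K) _ (X (N + j)))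

lemma freshHom_map (Q : MvPolynomial (Fin r) (MvPolynomial ℕ K)) :
    freshHom K r N (map (algebraMap _ _) Q) = algebraMap _ _ (insertVars K r N Q) := by
  have : (freshHom K r N).comp (map (algebraMap (MvPolynomial ℕ K) (RatFuncNat K))) =
      (algebraMap (MvPolynomial ℕ K) (RatFuncNat K)).comp (insertVars K r N).toRingHom := by
    apply MvPolynomial.ringHom_ext
    · intro b
      simp [freshHom, shiftVars_algebraMap, insertVars_C]
    · intro j
      simp [freshHom, insertVars_X]
  exact RingHom.congr_fun this Q

lemma freshHom_injective : Function.Injective (freshHom K r N) := by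
  rw [injective_iff_map_eq_zero]
  intro P hP
  obtain ⟨⟨Q, s⟩, h⟩ := IsLocalization.surj
    ((nonZeroDivisors (MvPolynomial ℕ K)).map (C (σ := Fin r))) P
  have hQ : freshHom K r N (algebraMap _ (MvPolynomial (Fin r) (RatFuncNat K)) Q) = 0 := by
    rw [← h, map_mul, hP, zero_mul]
  rw [MvPolynomial.algebraMap_def, freshHom_map] at hQ
  have hQ0 : Q = 0 := by
    rw [← map_eq_zero_iff _ (insertVars K r N).injective]
    exact (map_eq_zero_iff _ (IsFractionRing.injective (MvPolynomial ℕ K) _)).1 hQ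
  have hs := IsLocalization.map_units (MvPolynomial (Fin r) (RatFuncNat K)) s
  simp only [hQ0, map_zero] at h
  exact (hs.mul_left_eq_zero).1 h

/-- `freshHom` extends to an isomorphism `K(t₀, t₁, …)(T₁, …, Tᵣ) ≃ K(t₀, t₁, …)`. -/
noncomputable def freshEquiv :
    FractionRing (MvPolynomial (Fin r) (RatFuncNat K)) ≃+* RatFuncNat K :=
  RingEquiv.ofBijective (IsFractionRing.lift (freshHom_injective K r N))
    ⟨RingHom.injective _, by
      intro c
      have hb : ∀ b : MvPolynomial ℕ K, ∃ x, IsFractionRing.lift (K := FractionRing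
          (MvPolynomial (Fin r) (RatFuncNat K))) (freshHom_injective K r N) x =
          algebraMap (MvPolynomial ℕ K) (RatFuncNat K) b := by
        intro b
        refine ⟨algebraMap _ _ (map (algebraMap _ (RatFuncNat K)) ((insertVars K r N).symm b)), ?_⟩
        rw [IsFractionRing.lift_algebraMap, freshHom_map, RingEquiv.apply_symm_apply]
      obtain ⟨p, q, hq, rfl⟩ := IsFractionRing.div_surjective (A := MvPolynomial ℕ K) c
      obtain ⟨x, hx⟩ := hb p
      obtain ⟨y, hy⟩ := hb q
      exact ⟨x / y, by rw [map_div₀, hx, hy]⟩⟩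

lemma freshEquiv_algebraMap (P : MvPolynomial (Fin r) (RatFuncNat K)) :
    freshEquiv K r N (algebraMap _ _ P) = freshHom K r N P :=
  IsFractionRing.lift_algebraMap (freshHom_injective K r N) _

variable {K r N} in
lemma freshHom_eq_eval {P : MvPolynomial (Fin r) (RatFuncNat K)}
    (h : ∀ c ∈ P.coeffs, shiftVars K r N c = c) :
    freshHom K r N P = eval (fun j : Fin r => algebraMap (MvPolynomial ℕ K) _ (X (N + j))) P := by
  rw [freshHom, coe_eval₂Hom, eval₂_eq, eval_eq]
  refine Finset.sum_congr rfl fun m hm => ?_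
  rw [h _ (coeff_mem_coeffs m (by simpa using hm))]

/-- `K(t₀, t₁, …)` is Hilbertian, for any field `K`. Over this field the parameters `Tⱼ`
can be specialized to variables that do not occur in the given polynomials; this specialization is
as good as generic. -/
theorem isHilbertian_ratFuncNat : IsHilbertian (RatFuncNat K) := by
  classical
  intro r _ m f g hf _ hg
  set S : Finset (RatFuncNat K) :=
    g.coeffs ∪ Finset.univ.biUnion fun i => (f i).coeffs.biUnion fun P => P.coeffs with hS
  choose n hn using exists_shiftVars_eq (K := K) r
  -- all coefficients are fixed by `shiftVars`, so evaluation at `t_N, …` is the restriction of an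
  -- isomorphism `K(t₀, t₁, …)(T₁, …, Tᵣ) ≃ K(t₀, t₁, …)`
  set N := S.sup n with hN
  have hfix : ∀ c ∈ S, shiftVars K r N c = c := fun c hc => hn c N (Finset.le_sup hc)
  refine ⟨fun j => algebraMap (MvPolynomial ℕ K) _ (X (N + j)), ?_, fun i => ?_⟩
  · rw [← freshHom_eq_eval fun c hc => hfix c (Finset.mem_union_left _ hc)]
    exact (map_ne_zero_iff _ (freshHom_injective K r N)).2 hg
  · have h : (f i).map (eval fun j : Fin r => algebraMap (MvPolynomial ℕ K) _ (X (N + j))) =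
        Polynomial.mapEquiv (freshEquiv K r N) ((f i).map (algebraMap _ _)) := by
      ext k
      simp only [Polynomial.coeff_map, Polynomial.mapEquiv_apply, RingHom.coe_coe,
        freshEquiv_algebraMap]
      refine (freshHom_eq_eval fun c hc => hfix c (Finset.mem_union_right _ ?_)).symm
      simp only [Finset.mem_biUnion, Finset.mem_univ, true_and]
      refine ⟨i, (f i).coeff k, Polynomial.coeff_mem_coeffs ?_, hc⟩
      rintro h0
      simp [h0] at hc
    rw [h, MulEquiv.irreducible_iff]
    exact hf i

end Hilbertian

/-- Hilbertian fields are infinite: a finite field has a nonzero polynomial without non-roots. -/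
theorem IsHilbertian.infinite {K : Type u} [Field K] (h : IsHilbertian K) : Infinite K := by
  by_contra hfin
  rw [not_infinite_iff_finite] at hfin
  have := Fintype.ofFinite K
  obtain ⟨a, ha, -⟩ := h 1 one_pos 0 Fin.elim0
    (∏ c : K, (MvPolynomial.X 0 - MvPolynomial.C c)) (fun i => i.elim0) (fun i => i.elim0)
    (Finset.prod_ne_zero_iff.2 fun c _ hc => by
      have := congrArg (MvPolynomial.eval fun _ => c + 1) hc
      simp at this)
  apply ha
  rw [map_prod]
  exact Finset.prod_eq_zero (Finset.mem_univ (a 0)) (by simp)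

/-- `k` is algebraically closed in `k(t₀, t₁, …)`. -/
lemma mem_range_of_isAlgebraic_ratFuncNat {k : Type u} [Field k] {y : RatFuncNat k}
    (hy : IsAlgebraic k y) : y ∈ Set.range (algebraMap k (RatFuncNat k)) := by
  have h1 : IsIntegral (MvPolynomial ℕ k) y := hy.isIntegral.tower_top
  obtain ⟨P, rfl⟩ := IsIntegrallyClosed.isIntegral_iff.1 h1
  have h2 : IsIntegral k P :=
    (isIntegral_algHom_iff (IsScalarTower.toAlgHom k (MvPolynomial ℕ k) (RatFuncNat k))
      (IsFractionRing.injective _ _)).1 hy.isIntegral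
  by_cases h0 : P = 0
  · exact ⟨0, by simp [h0]⟩
  · obtain ⟨c, -, rfl⟩ := MvPolynomial.isUnit_iff_eq_C_of_isReduced.1 (h2.isUnit h0)
    exact ⟨c, by rw [IsScalarTower.algebraMap_apply k (MvPolynomial ℕ k)]; rfl⟩

open Polynomial

/-! ### Clauses and their solutions -/

/-- A conjunction of equations `q(x, y) = 0`, for `q` in the list, with one inequation
`g(x, y) ≠ 0`. The outer variable of `ℤ[X][X]` is `y`, the inner one is `x`. -/
abbrev Clause := List ℤ[X][X] × ℤ[X][X]

/-- Evaluation of integer polynomials at `a`. -/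
noncomputable abbrev evalAt {K : Type*} [Field K] (a : K) : ℤ[X] →+* K :=
  eval₂RingHom (Int.castRingHom K) a

namespace Clause

variable {K : Type*} [Field K] {L : Type*} [Field L]

/-- The clause is true at the point `(a, y)`. -/
def Holds (c : Clause) (a y : K) : Prop :=
  (∀ q ∈ c.1, q.eval₂ (evalAt a) y = 0) ∧ c.2.eval₂ (evalAt a) y ≠ 0

/-- The clause is true at `(a, y)` for `y` transcendental over the field of `a`. -/
def HoldsGen (c : Clause) (a : K) : Prop :=
  (∀ q ∈ c.1, q.map (evalAt a) = 0) ∧ c.2.map (evalAt a) ≠ 0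

lemma evalAt_map (φ : K →+* L) (a : K) : evalAt (φ a) = φ.comp (evalAt a) := by
  ext <;> simp

lemma holds_map (φ : K →+* L) {c : Clause} {a y : K} :
    c.Holds (φ a) (φ y) ↔ c.Holds a y := by
  simp only [Holds, evalAt_map, ← hom_eval₂, map_eq_zero, ne_eq]

lemma HoldsGen.exists_holds [Infinite K] {c : Clause} {a : K} (h : c.HoldsGen a) :
    ∃ y, c.Holds a y := by
  obtain ⟨y, hy⟩ : ∃ y, (c.2.map (evalAt a)).eval y ≠ 0 := by
    by_contra! h0
    exact h.2 (Polynomial.funext fun y => by simp [h0 y])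
  refine ⟨y, fun q hq => ?_, ?_⟩
  · rw [← eval_map, h.1 q hq, eval_zero]
  · rwa [← eval_map]

/-- A solution in `k(t₀, t₁, …)` over a point of `k` is generic or lies in `k`. -/
lemma Holds.ratFuncNat {k : Type u} [Field k] {c : Clause} {a : k} {y : RatFuncNat k}
    (h : c.Holds (algebraMap k (RatFuncNat k) a) y) : c.HoldsGen a ∨ ∃ y, c.Holds a y := by
  by_cases hy : IsAlgebraic k y
  · obtain ⟨y, rfl⟩ := mem_range_of_isAlgebraic_ratFuncNat hy
    exact .inr ⟨y, (holds_map _).1 h⟩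
  · have key (q : ℤ[X][X]) : q.eval₂ (evalAt (algebraMap k (RatFuncNat k) a)) y =
        aeval y (q.map (evalAt a)) := by
      rw [evalAt_map, aeval_def, eval₂_map]
    refine .inl ⟨fun q hq => ?_, fun h0 => h.2 (by rw [key, h0, map_zero])⟩
    by_contra h0
    exact hy ⟨_, h0, by rw [← key]; exact h.1 q hq⟩

end Clause

/-- `∃ y, Φ(a, y)` is true in `K`, where the list `Φ` of clauses stands for their disjunction. -/
def Solvable (Φ : List Clause) {K : Type*} [Field K] (a : K) : Prop :=
  ∃ c ∈ Φ, ∃ y, c.Holds a y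

/-- `Φ(a, y)` is true for `y` transcendental over the field of `a`. -/
def SolvableGen (Φ : List Clause) {K : Type*} [Field K] (a : K) : Prop :=
  ∃ c ∈ Φ, c.HoldsGen a

/-- `∀ x ∃ y, Φ(x, y)` is true in all infinite fields. -/
def TrueInInfinite (Φ : List Clause) : Prop :=
  ∀ (K : Type u) [Field K] [Infinite K] (a : K), Solvable Φ a

lemma SolvableGen.solvable {Φ : List Clause} {K : Type*} [Field K] [Infinite K] {a : K}
    (h : SolvableGen Φ a) : Solvable Φ a :=
  let ⟨c, hc, h⟩ := h
  ⟨c, hc, h.exists_holds⟩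

lemma Solvable.map {Φ : List Clause} {K L : Type*} [Field K] [Field L] (φ : K →+* L) {a : K}
    (h : Solvable Φ a) : Solvable Φ (φ a) :=
  let ⟨c, hc, y, h⟩ := h
  ⟨c, hc, φ y, (Clause.holds_map φ).2 h⟩

lemma Solvable.ratFuncNat {Φ : List Clause} {k : Type u} [Field k] {a : k}
    (h : Solvable Φ (algebraMap k (RatFuncNat k) a)) : SolvableGen Φ a ∨ Solvable Φ a := by
  obtain ⟨c, hc, y, h⟩ := h
  exact h.ratFuncNat.imp (fun h => ⟨c, hc, h⟩) fun h => ⟨c, hc, h⟩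

instance {k : Type u} [Field k] : Infinite (RatFuncNat k) :=
  (isHilbertian_ratFuncNat k).infinite

/-- For a sentence that is true in all infinite fields, also finite fields have solutions if
generic ones are admitted. -/
lemma TrueInInfinite.solvableGen_or_solvable {Φ : List Clause} (h : TrueInInfinite.{u} Φ)
    {k : Type} [Field k] (a : k) : SolvableGen Φ a ∨ Solvable Φ a := by
  let φ := (ULift.ringEquiv.{0, u} (R := RatFuncNat k))
  have h1 := (h (ULift.{u} (RatFuncNat k)) (φ.symm (algebraMap k _ a))).map φ.toRingHom
  simp only [RingEquiv.toRingHom_eq_coe, RingHom.coe_coe, RingEquiv.apply_symm_apply] at h1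
  exact h1.ratFuncNat

/-! ### Finite covers of the spectrum -/

section Cover

variable {R : Type*} [CommRing R]

/-- In a Noetherian ring, a cover of the spectrum by sets `V(zs) ∩ D(g)` has a finite subcover. -/
lemma exists_finite_cover [IsNoetherianRing R] (F : Set (List R × R))
    (h : ∀ P : Ideal R, P.IsPrime → ∃ i ∈ F, (∀ z ∈ i.1, z ∈ P) ∧ i.2 ∉ P) :
    ∃ l : List (List R × R), (∀ i ∈ l, i ∈ F) ∧
      ∀ P : Ideal R, P.IsPrime → ∃ i ∈ l, (∀ z ∈ i.1, z ∈ P) ∧ i.2 ∉ P := by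
  suffices H : ∀ I : Ideal R, ∃ l : List (List R × R), (∀ i ∈ l, i ∈ F) ∧
      ∀ P : Ideal R, P.IsPrime → I ≤ P → ∃ i ∈ l, (∀ z ∈ i.1, z ∈ P) ∧ i.2 ∉ P by
    obtain ⟨l, h1, h2⟩ := H ⊥
    exact ⟨l, h1, fun P hP => h2 P hP bot_le⟩
  intro I
  induction I using IsNoetherian.induction with
  | hgt I ih =>
  have hlt {a : R} (ha : a ∉ I) : I < I ⊔ Ideal.span {a} :=
    lt_of_le_of_ne le_sup_left fun h0 =>
      ha (h0 ▸ Ideal.mem_sup_right (Ideal.mem_span_singleton_self a))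
  have hle {a : R} {P : Ideal R} (hI : I ≤ P) (ha : a ∈ P) : I ⊔ Ideal.span {a} ≤ P :=
    sup_le hI ((Ideal.span_singleton_le_iff_mem P).2 ha)
  by_cases hI : Ideal.IsPrime I
  · obtain ⟨i, hi, hz, hg⟩ := h I hI
    obtain ⟨l, h1, h2⟩ := ih _ (hlt hg)
    refine ⟨i :: l, by simpa using ⟨hi, by simpa using h1⟩, fun P hP hIP => ?_⟩
    by_cases hgP : i.2 ∈ P
    · obtain ⟨j, hj, hj'⟩ := h2 P hP (hle hIP hgP)
      exact ⟨j, List.mem_cons_of_mem _ hj, hj'⟩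
    · exact ⟨i, List.mem_cons_self, fun z hz' => hIP (hz z hz'), hgP⟩
  · by_cases ht : I = ⊤
    · exact ⟨[], by simp, fun P _ hIP => absurd (top_le_iff.1 (ht ▸ hIP)) ‹P.IsPrime›.ne_top⟩
    · obtain ⟨a, ha, b, hb, hab⟩ : ∃ a, a ∉ I ∧ ∃ b, b ∉ I ∧ a * b ∈ I := by
        by_contra! h0
        exact hI ⟨ht, fun {a b} hab => by
          by_contra! h1
          exact h0 a h1.1 b h1.2 hab⟩
      obtain ⟨l, h1, h2⟩ := ih _ (hlt ha)
      obtain ⟨l', h1', h2'⟩ := ih _ (hlt hb)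
      refine ⟨l ++ l', fun i hi => (List.mem_append.1 hi).elim (h1 i) (h1' i),
        fun P hP hIP => ?_⟩
      rcases hP.mem_or_mem (hIP hab) with h0 | h0
      · obtain ⟨j, hj, hj'⟩ := h2 P hP (hle hIP h0)
        exact ⟨j, List.mem_append_left _ hj, hj'⟩
      · obtain ⟨j, hj, hj'⟩ := h2' P hP (hle hIP h0)
        exact ⟨j, List.mem_append_right _ hj, hj'⟩

/-- The complement of a finite union of sets `V(zs) ∩ D(g)` is the union of the sets
`D(h) ∩ V(G)`, for `(h, G)` in this list: a point outside of `V(zs) ∩ D(g)` is outside of some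
`V(z)` or inside of `V(g)`. -/
def branches : List (List R × R) → List (R × List R)
  | [] => [(1, [])]
  | i :: l => (branches l).flatMap fun s => (s.1, i.2 :: s.2) :: i.1.map fun z => (z * s.1, s.2)

lemma not_mem_of_mem_branches {P : Ideal R} {l : List (List R × R)}
    {s : R × List R} (hs : s ∈ branches l) (h : s.1 ∉ P) (hG : ∀ g ∈ s.2, g ∈ P) :
    ∀ i ∈ l, (∀ z ∈ i.1, z ∈ P) → i.2 ∈ P := by
  induction l generalizing s with
  | nil => simp
  | cons j l ih =>
    simp only [branches, List.mem_flatMap, List.mem_cons, List.mem_map] at hs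
    obtain ⟨s, hs, rfl | ⟨z, hz, rfl⟩⟩ := hs
    · intro i hi hzs
      rcases List.mem_cons.1 hi with rfl | hi
      · exact hG _ List.mem_cons_self
      · exact ih hs h (fun g hg => hG g (List.mem_cons_of_mem _ hg)) i hi hzs
    · intro i hi hzs
      rcases List.mem_cons.1 hi with rfl | hi
      · exact absurd (P.mul_mem_right _ (hzs z hz)) h
      · exact ih hs (fun h0 => h (P.mul_mem_left _ h0)) hG i hi hzs

/-- For a cover of the spectrum, the Nullstellensatz certifies that the complement is empty. -/
lemma exists_pow_mem_span_of_cover {l : List (List R × R)}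
    (h : ∀ P : Ideal R, P.IsPrime → ∃ i ∈ l, (∀ z ∈ i.1, z ∈ P) ∧ i.2 ∉ P)
    {s : R × List R} (hs : s ∈ branches l) : ∃ n, s.1 ^ n ∈ Ideal.span {g | g ∈ s.2} := by
  by_contra h0
  have h1 : s.1 ∉ (Ideal.span {g | g ∈ s.2}).radical := h0
  rw [Ideal.radical_eq_sInf, Submodule.mem_sInf] at h1
  push Not at h1
  obtain ⟨P, ⟨hP, hP'⟩, h2⟩ := h1
  obtain ⟨i, hi, hz, hg⟩ := h P hP'
  exact hg (not_mem_of_mem_branches hs h2 (fun g hg => hP (Ideal.subset_span hg)) i hi hz)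

lemma exists_mem_branches {K : Type*} [Field K] (φ : R →+* K) {l : List (List R × R)}
    (h : ∀ i ∈ l, (∀ z ∈ i.1, φ z = 0) → φ i.2 = 0) :
    ∃ s ∈ branches l, φ s.1 ≠ 0 ∧ ∀ g ∈ s.2, φ g = 0 := by
  induction l with
  | nil => exact ⟨(1, []), by simp [branches], by simp, by simp⟩
  | cons i l ih =>
    obtain ⟨s, hs, h1, h2⟩ := ih fun j hj => h j (List.mem_cons_of_mem _ hj)
    simp only [branches, List.mem_flatMap]
    by_cases hz : ∀ z ∈ i.1, φ z = 0
    · exact ⟨_, ⟨s, hs, List.mem_cons_self⟩, h1, by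
        simpa using ⟨h i List.mem_cons_self hz, by simpa using h2⟩⟩
    · push Not at hz
      obtain ⟨z, hz, hz0⟩ := hz
      exact ⟨_, ⟨s, hs, List.mem_cons_of_mem _ (List.mem_map.2 ⟨z, hz, rfl⟩)⟩,
        by simpa using ⟨hz0, h1⟩, h2⟩

/-- A certificate that the complement is empty yields a member of the cover at every point. -/
lemma exists_of_forall_branches {K : Type*} [Field K] (φ : R →+* K) {l : List (List R × R)}
    (h : ∀ s ∈ branches l, ∃ n, s.1 ^ n ∈ Ideal.span {g | g ∈ s.2}) :
    ∃ i ∈ l, (∀ z ∈ i.1, φ z = 0) ∧ φ i.2 ≠ 0 := by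
  by_contra! h0
  obtain ⟨s, hs, h1, h2⟩ := exists_mem_branches φ h0
  obtain ⟨n, hn⟩ := h s hs
  have h3 : Ideal.span {g | g ∈ s.2} ≤ RingHom.ker φ := Ideal.span_le.2 fun g hg => h2 g hg
  have h4 := h3 hn
  rw [RingHom.mem_ker, map_pow] at h4
  exact pow_ne_zero n h1 h4

end Cover

/-! ### Bounds for rational solutions -/

/-- A bound for the coefficients of the polynomials that represent the possible solutions, when
degrees and coefficients of the given polynomials are bounded by `s`. -/
def coeffBound (s : ℕ) : ℕ := (2 * (s + 1)) ^ (s + 5)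

/-- Integer polynomials of degree at most `s` with coefficients of absolute value at most `s`. -/
def SmallPoly (s : ℕ) (f : ℤ[X]) : Prop := f.natDegree ≤ s ∧ ∀ i, (f.coeff i).natAbs ≤ s

/-- Bivariate integer polynomials whose coefficients, as polynomials in the outer variable `y`, are
of degree at most `s` with coefficients at most `s`. The degree in `y` is not restricted. -/
def SmallPoly₂ (s : ℕ) (q : ℤ[X][X]) : Prop := ∀ j, SmallPoly s (q.coeff j)

/-- The integer polynomials among which numerators and denominators of solutions are searched. -/
def InBox (s : ℕ) (f : ℤ[X]) : Prop :=
  f.natDegree ≤ 2 * s ∧ ∀ i, (f.coeff i).natAbs ≤ coeffBound s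

/-- `y` is a fraction in `a` with numerator and denominator from the box. -/
def IsBoxFraction (s : ℕ) {K : Type*} [Field K] (a y : K) : Prop :=
  ∃ u v : ℤ[X], InBox s u ∧ InBox s v ∧ evalAt a v ≠ 0 ∧ evalAt a u = y * evalAt a v

lemma one_le_coeffBound (s : ℕ) : 1 ≤ coeffBound s := Nat.one_le_pow _ _ (by omega)

lemma self_le_coeffBound (s : ℕ) : s ≤ coeffBound s :=
  calc s ≤ (2 * (s + 1)) ^ 1 := by rw [pow_one]; omega
    _ ≤ _ := Nat.pow_le_pow_right (by omega) (by omega)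

lemma two_pow_mul_le_coeffBound (s : ℕ) : 2 ^ s * ((s + 1) * s) ≤ coeffBound s :=
  calc 2 ^ s * ((s + 1) * s) ≤ (2 * (s + 1)) ^ s * ((2 * (s + 1)) * (2 * (s + 1))) := by
        gcongr <;> omega
    _ = (2 * (s + 1)) ^ (s + 2) := by ring
    _ ≤ _ := Nat.pow_le_pow_right (by omega) (by omega)

lemma inBox_zero (s : ℕ) : InBox s 0 := by simp [InBox]

lemma inBox_one (s : ℕ) : InBox s 1 := by
  refine ⟨by simp, fun i => ?_⟩
  rw [coeff_one]
  split_ifs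
  · simpa using one_le_coeffBound s
  · simp

/-- The rational root theorem, with a bound for the numerator that takes into account that the
constant coefficient may vanish. -/
lemma exists_dvd_coeff_of_root {A K : Type*} [CommRing A] [IsDomain A]
    [UniqueFactorizationMonoid A] [Field K] [Algebra A K] [IsFractionRing A K] {f : A[X]}
    (hf : f ≠ 0) {y : K} (hy : aeval y f = 0) (hy0 : y ≠ 0) :
    ∃ u v : A, v ≠ 0 ∧ y * algebraMap A K v = algebraMap A K u ∧
      (∃ j, f.coeff j ≠ 0 ∧ u ∣ f.coeff j) ∧ ∃ j, f.coeff j ≠ 0 ∧ v ∣ f.coeff j := by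
  -- divide by the largest power of the variable, so that the constant coefficient is nonzero
  obtain ⟨g, hg, hg0⟩ := exists_eq_pow_rootMultiplicity_mul_and_not_dvd f hf 0
  set n := rootMultiplicity 0 f
  rw [C_0, sub_zero] at hg hg0
  have hgy : aeval y g = 0 := by
    rw [hg, map_mul, map_pow, aeval_X] at hy
    exact (mul_eq_zero.1 hy).resolve_left (pow_ne_zero _ hy0)
  refine ⟨IsFractionRing.num A y, IsFractionRing.den A y,
    nonZeroDivisors.ne_zero (IsFractionRing.den A y).2, ?_, ⟨n, ?_, ?_⟩, f.natDegree, ?_, ?_⟩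
  · have := IsLocalization.mk'_spec K (IsFractionRing.num A y) (IsFractionRing.den A y)
    rwa [IsFractionRing.mk'_num_den A y] at this
  · rw [X_dvd_iff] at hg0
    simpa [hg, coeff_X_pow_mul'] using hg0
  · have := num_dvd_of_is_root hgy
    have h2 : f.coeff n = g.coeff 0 := by
      conv_lhs => rw [hg]
      simp [coeff_X_pow_mul']
    rwa [h2]
  · simpa using hf
  · have := den_dvd_of_is_root hgy
    have h2 : f.coeff f.natDegree = g.leadingCoeff := by
      rw [coeff_natDegree]
      conv_lhs => rw [hg]
      rw [leadingCoeff_mul, leadingCoeff_X_pow, one_mul]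
    rwa [h2]

lemma SmallPoly.mahlerMeasure_le {s : ℕ} {f : ℤ[X]} (h : SmallPoly s f) :
    (f.map (Int.castRingHom ℂ)).mahlerMeasure ≤ (s + 1) * s := by
  refine (mahlerMeasure_le_sum_norm_coeff _).trans ?_
  rw [sum_def]
  refine (Finset.sum_le_card_nsmul _ _ (s : ℝ) fun i _ => ?_).trans ?_
  · simp only [coeff_map, eq_intCast, Complex.norm_intCast]
    rw [← Int.cast_abs, Int.abs_eq_natAbs]
    exact_mod_cast h.2 i
  · rw [nsmul_eq_mul]
    gcongr
    have := (card_supp_le_succ_natDegree (f.map (Int.castRingHom ℂ)))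
    have h2 := natDegree_map_le (f := Int.castRingHom ℂ) (p := f)
    have h1 := h.1
    exact_mod_cast (by omega)

/-- Coefficients of complex divisors, by Mahler's inequality. -/
lemma SmallPoly.norm_coeff_le {s : ℕ} {f : ℤ[X]} (h : SmallPoly s f) {g k : ℂ[X]}
    (hgk : g * k = f.map (Int.castRingHom ℂ)) (hg : g.natDegree ≤ s) (hk : 1 ≤ k.mahlerMeasure)
    (i : ℕ) : ‖g.coeff i‖ ≤ 2 ^ s * ((s + 1) * s) := by
  refine (norm_coeff_le_choose_mul_mahlerMeasure_of_one_le_mahlerMeasure i g k hk).trans ?_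
  rw [hgk]
  gcongr
  · exact mahlerMeasure_nonneg _
  · have : g.natDegree.choose i ≤ 2 ^ s :=
      (Nat.choose_le_two_pow _ _).trans (Nat.pow_le_pow_right (by omega) hg)
    exact_mod_cast this
  · exact h.mahlerMeasure_le

lemma SmallPoly.inBox_of_dvd {s : ℕ} {f u : ℤ[X]} (h : SmallPoly s f) (hf : f ≠ 0)
    (hu : u ∣ f) : InBox s u := by
  obtain ⟨k, rfl⟩ := hu
  have hdeg : u.natDegree ≤ s := (natDegree_le_of_dvd (dvd_mul_right u k) hf).trans h.1
  refine ⟨by omega, fun i => ?_⟩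
  refine le_trans ?_ (two_pow_mul_le_coeffBound s)
  have := h.norm_coeff_le (g := u.map (Int.castRingHom ℂ)) (k := k.map (Int.castRingHom ℂ))
    (by rw [Polynomial.map_mul]) (natDegree_map_le.trans hdeg)
    (one_le_mahlerMeasure_of_ne_zero (right_ne_zero_of_mul hf)) i
  simp only [coeff_map, eq_intCast, Complex.norm_intCast] at this
  rw [← Int.cast_abs, Int.abs_eq_natAbs] at this
  exact_mod_cast this

/-- Solutions over `ℚ(x)`: by the rational root theorem in `ℤ[x]`, numerator and denominator divide
coefficients of the equation. -/
lemma isBoxFraction_of_root_rat {s : ℕ} {q : ℤ[X][X]} (hs : SmallPoly₂ s q)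
    {y : FractionRing ℤ[X]}
    (hq : q.map (evalAt (algebraMap ℤ[X] (FractionRing ℤ[X]) X)) ≠ 0)
    (hy : q.eval₂ (evalAt (algebraMap ℤ[X] (FractionRing ℤ[X]) X)) y = 0) :
    IsBoxFraction s (algebraMap ℤ[X] (FractionRing ℤ[X]) X) y := by
  have he : evalAt (algebraMap ℤ[X] (FractionRing ℤ[X]) X) = algebraMap _ _ := by
    ext <;> simp
  rw [he] at hq hy
  rw [IsBoxFraction, he]
  by_cases hy0 : y = 0
  · exact ⟨0, 1, inBox_zero s, inBox_one s, by simp, by simp [hy0]⟩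
  · have hq0 : q ≠ 0 := by
      rintro rfl
      simp at hq
    obtain ⟨u, v, hv, huv, ⟨j, hj, hj'⟩, k, hk, hk'⟩ := exists_dvd_coeff_of_root hq0 hy hy0
    exact ⟨u, v, (hs j).inBox_of_dvd hj hj', (hs k).inBox_of_dvd hk hk', by simpa using hv,
      huv.symm⟩

/-- Polynomials modulo `p` have representatives with coefficients in `[0, p)`. -/
lemma exists_lift_zmod {p : ℕ} [NeZero p] (f : (ZMod p)[X]) :
    ∃ g : ℤ[X], g.map (Int.castRingHom (ZMod p)) = f ∧ g.natDegree ≤ f.natDegree ∧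
      ∀ i, (g.coeff i).natAbs ≤ p := by
  refine ⟨∑ i ∈ Finset.range (f.natDegree + 1), C ((f.coeff i).val : ℤ) * X ^ i, ?_, ?_, ?_⟩
  · rw [Polynomial.map_sum]
    conv_rhs => rw [f.as_sum_range_C_mul_X_pow]
    refine Finset.sum_congr rfl fun i _ => ?_
    rw [Polynomial.map_mul, Polynomial.map_pow, map_X, map_C, eq_intCast, Int.cast_natCast,
      ZMod.natCast_zmod_val]
  · refine natDegree_sum_le_of_forall_le _ _ fun i hi => ?_
    exact (natDegree_C_mul_X_pow_le _ _).trans (by simpa [Nat.lt_succ_iff] using hi)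
  · intro i
    simp only [finsetSum_coeff, coeff_C_mul, coeff_X_pow, mul_ite, mul_one, mul_zero,
      Finset.sum_ite_eq, Finset.mem_range]
    split_ifs
    · rw [Int.natAbs_natCast]
      exact (ZMod.val_lt (f.coeff i)).le
    · simp

/-- Solutions over `𝔽ₚ(x)`. Only the degrees of numerator and denominator need a bound here, as the
coefficients have representatives in `[0, p)`. -/
lemma isBoxFraction_of_root_zmod {p s : ℕ} [Fact p.Prime] (hp : p ≤ s) {q : ℤ[X][X]}
    (hs : SmallPoly₂ s q) {y : FractionRing (ZMod p)[X]}
    (hq : q.map (evalAt (algebraMap (ZMod p)[X] (FractionRing (ZMod p)[X]) X)) ≠ 0)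
    (hy : q.eval₂ (evalAt (algebraMap (ZMod p)[X] (FractionRing (ZMod p)[X]) X)) y = 0) :
    IsBoxFraction s (algebraMap (ZMod p)[X] (FractionRing (ZMod p)[X]) X) y := by
  have he : evalAt (algebraMap (ZMod p)[X] (FractionRing (ZMod p)[X]) X) =
      (algebraMap _ _).comp (mapRingHom (Int.castRingHom (ZMod p))) := by
    ext <;> simp
  rw [he] at hq hy
  rw [IsBoxFraction, he]
  by_cases hy0 : y = 0
  · exact ⟨0, 1, inBox_zero s, inBox_one s, by simp, by simp [hy0]⟩
  · have hq0 : q.map (mapRingHom (Int.castRingHom (ZMod p))) ≠ 0 := by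
      intro h0
      rw [← map_map, h0] at hq
      simp at hq
    rw [← eval₂_map] at hy
    obtain ⟨u, v, hv, huv, ⟨j, hj, hj'⟩, k, hk, hk'⟩ := exists_dvd_coeff_of_root hq0 hy hy0
    have key {w : (ZMod p)[X]} {j : ℕ}
        (hj : (q.map (mapRingHom (Int.castRingHom (ZMod p)))).coeff j ≠ 0)
        (hw : w ∣ (q.map (mapRingHom (Int.castRingHom (ZMod p)))).coeff j) :
        ∃ g : ℤ[X], g.map (Int.castRingHom (ZMod p)) = w ∧ InBox s g := by
      obtain ⟨g, hg, h1, h2⟩ := exists_lift_zmod w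
      refine ⟨g, hg, ?_, fun i => (h2 i).trans (hp.trans (self_le_coeffBound s))⟩
      have h3 := natDegree_le_of_dvd hw hj
      have h4 : ((q.map (mapRingHom (Int.castRingHom (ZMod p)))).coeff j).natDegree ≤ s := by
        rw [coeff_map]
        exact natDegree_map_le.trans (hs j).1
      omega
    obtain ⟨U, rfl, hU⟩ := key hj hj'
    obtain ⟨V, rfl, hV⟩ := key hk hk'
    exact ⟨U, V, hU, hV, by simpa using hv, huv.symm⟩

/-! ### Bounds for solutions in number fields -/

section NumberField

variable {K : Type*} [Field K] [NumberField K]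

/-- Expansion of an element, multiplied by `μ'(α)`, in powers of `α`: the
basis dual to `1, α, α², …` under the trace is `bᵢ / μ'(α)` with `μ / (X - α) = ∑ bᵢ Xⁱ`. -/
lemma mul_derivative_eq_sum (pb : PowerBasis ℚ K) (w : K) :
    w * aeval pb.gen (derivative (minpoly ℚ pb.gen)) =
      ∑ i : Fin pb.dim,
        Algebra.trace ℚ K (w * (minpolyDiv ℚ pb.gen).coeff i) • pb.gen ^ (i : ℕ) := by
  set δ := aeval pb.gen (derivative (minpoly ℚ pb.gen)) with hδ
  have hδ0 : δ ≠ 0 :=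
    (Algebra.IsSeparable.isSeparable ℚ pb.gen).aeval_derivative_ne_zero (minpoly.aeval _ _)
  have h1 := pb.basis.sum_repr (w * δ)
  rw [← h1]
  refine Finset.sum_congr rfl fun i _ => ?_
  rw [pb.basis_eq_pow]
  congr 1
  have h2 := pb.basis.traceDual.traceDual_repr_apply (w * δ) i
  rw [Module.Basis.traceDual_traceDual, Module.Basis.traceDual_powerBasis_eq, ← hδ] at h2
  rw [h2, Algebra.traceForm_apply]
  congr 1
  field_simp

/-- Roots of complex polynomials in terms of the size of the coefficients. -/
lemma norm_leadingCoeff_mul_root_le {f : ℂ[X]} (hf : f ≠ 0) {z : ℂ} (hz : f.eval z = 0) {B : ℝ}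
    (hB : ∀ j, ‖f.coeff j‖ ≤ B) : ‖f.leadingCoeff * z‖ ≤ 2 * B := by
  have h0 : 0 < ‖f.leadingCoeff‖ := by simpa using hf
  have h1 := IsRoot.norm_lt_cauchyBound hf hz
  have hB0 : 0 ≤ B := (norm_nonneg _).trans (hB 0)
  have h2 : (((Finset.range f.natDegree).sup (‖f.coeff ·‖₊) : NNReal) : ℝ) ≤ B := by
    have : (Finset.range f.natDegree).sup (‖f.coeff ·‖₊) ≤ ⟨B, hB0⟩ :=
      Finset.sup_le fun j _ => by exact_mod_cast hB j
    exact_mod_cast this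
  have h3 : ‖z‖ < (((Finset.range f.natDegree).sup (‖f.coeff ·‖₊) : NNReal) : ℝ) /
      ‖f.leadingCoeff‖ + 1 := by
    have := NNReal.coe_lt_coe.2 h1
    simpa [cauchyBound] using this
  have h4 : ‖f.leadingCoeff‖ ≤ B := hB f.natDegree
  rw [norm_mul]
  calc ‖f.leadingCoeff‖ * ‖z‖ ≤ ‖f.leadingCoeff‖ *
        ((((Finset.range f.natDegree).sup (‖f.coeff ·‖₊) : NNReal) : ℝ) / ‖f.leadingCoeff‖ +
          1) := by gcongr
    _ = (((Finset.range f.natDegree).sup (‖f.coeff ·‖₊) : NNReal) : ℝ) + ‖f.leadingCoeff‖ := by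
        field_simp
    _ ≤ 2 * B := by linarith

lemma SmallPoly.norm_eval_le {s : ℕ} {f : ℤ[X]} (h : SmallPoly s f) {z : ℂ} (hz : ‖z‖ ≤ s + 1) :
    ‖f.eval₂ (Int.castRingHom ℂ) z‖ ≤ (s + 1) * (s * (s + 1) ^ s) := by
  rw [eval₂_eq_sum_range' _ (Nat.lt_succ_of_le h.1)]
  refine (norm_sum_le _ _).trans ((Finset.sum_le_card_nsmul _ _ ((s : ℝ) * (s + 1) ^ s)
    fun i hi => ?_).trans (by simp))
  rw [norm_mul, norm_pow]
  have h1 : i ≤ s := by simpa [Nat.lt_succ_iff] using hi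
  gcongr
  · rw [eq_intCast, Complex.norm_intCast, ← Int.cast_abs, Int.abs_eq_natAbs]
    exact_mod_cast h.2 i
  · calc ‖z‖ ^ i ≤ ((s : ℝ) + 1) ^ i := by gcongr
      _ ≤ ((s : ℝ) + 1) ^ s := pow_le_pow_right₀ (by simp) h1

lemma SmallPoly.norm_root_le {s : ℕ} {f : ℤ[X]} (h : SmallPoly s f) (hf : f.Monic) {z : ℂ}
    (hz : f.eval₂ (Int.castRingHom ℂ) z = 0) : ‖z‖ ≤ s + 1 := by
  have h1 := IsRoot.norm_lt_cauchyBound (hf.map (Int.castRingHom ℂ)).ne_zero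
    (by rwa [IsRoot, eval_map])
  have h2 : ‖z‖ < _ := NNReal.coe_lt_coe.2 h1
  refine h2.le.trans ?_
  rw [cauchyBound, (hf.map _).leadingCoeff]
  simp only [nnnorm_one, div_one, NNReal.coe_add, NNReal.coe_one, add_le_add_iff_right]
  have : (Finset.range (f.map (Int.castRingHom ℂ)).natDegree).sup
      (‖(f.map (Int.castRingHom ℂ)).coeff ·‖₊) ≤ (s : NNReal) :=
    Finset.sup_le fun j _ => by
      rw [← NNReal.coe_le_coe]
      simp only [coeff_map, eq_intCast, coe_nnnorm, Complex.norm_intCast, NNReal.coe_natCast]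
      rw [← Int.cast_abs, Int.abs_eq_natAbs]
      exact_mod_cast h.2 j
  exact_mod_cast this

lemma SmallPoly.inBox_mul_derivative {s : ℕ} {f g : ℤ[X]} (hf : SmallPoly s f)
    (hg : SmallPoly s g) : InBox s (f * derivative g) := by
  constructor
  · have h1 := natDegree_derivative_le g
    have h2 := natDegree_mul_le (p := f) (q := derivative g)
    have := hf.1
    have := hg.1
    omega
  · intro n
    rw [coeff_mul]
    refine (Int.natAbs_sum_le _ _).trans ?_
    have hterm : ∀ x ∈ Finset.HasAntidiagonal.antidiagonal n,
        (f.coeff x.1 * (derivative g).coeff x.2).natAbs ≤ if x.1 ≤ s then s * (s * s) else 0 := by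
      intro x _
      split_ifs with hx
      · rw [Int.natAbs_mul]
        refine Nat.mul_le_mul (hf.2 _) ?_
        by_cases hx2 : x.2 + 1 ≤ s
        · rw [coeff_derivative, Int.natAbs_mul]
          refine Nat.mul_le_mul (hg.2 _) ?_
          omega
        · rw [coeff_derivative, coeff_eq_zero_of_natDegree_lt (by have := hg.1; omega)]
          simp
      · rw [coeff_eq_zero_of_natDegree_lt (by have := hf.1; omega)]
        simp
    refine (Finset.sum_le_sum hterm).trans ?_
    rw [Finset.Nat.sum_antidiagonal_eq_sum_range_succ_mk, ← Finset.sum_filter]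
    have hcard : ((Finset.range n.succ).filter fun k => k ≤ s).card ≤ s + 1 := by
      calc _ ≤ (Finset.range (s + 1)).card := Finset.card_le_card fun k hk => by
              simp only [Finset.mem_filter, Finset.mem_range] at hk ⊢; omega
        _ = s + 1 := by simp
    rw [Finset.sum_const, smul_eq_mul]
    calc _ ≤ (s + 1) * (s * (s * s)) := Nat.mul_le_mul_right _ hcard
      _ ≤ (2 * (s + 1)) * ((2 * (s + 1)) * ((2 * (s + 1)) * (2 * (s + 1)))) := by gcongr <;> omega
      _ = (2 * (s + 1)) ^ 4 := by ring
      _ ≤ _ := Nat.pow_le_pow_right (by omega) (by omega)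

/-- The left hand side bounds a trace: there are at most `s` conjugates, and each is the product of
a conjugate of `l(α) y` and a conjugate of a coefficient of `μ / (X - α)`. -/
lemma trace_bound_le_coeffBound (s : ℕ) :
    s * (2 * ((s + 1) * (s * (s + 1) ^ s)) * (2 ^ s * ((s + 1) * s))) ≤ coeffBound s := by
  calc _ ≤ (s + 1) * (2 * ((s + 1) * ((s + 1) * (s + 1) ^ s)) * (2 ^ s * ((s + 1) * (s + 1)))) := by
        gcongr <;> omega
    _ = 2 ^ (s + 1) * (s + 1) ^ (s + 5) := by ring
    _ ≤ 2 ^ (s + 5) * (s + 1) ^ (s + 5) :=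
        Nat.mul_le_mul_right _ (Nat.pow_le_pow_right (by omega) (by omega))
    _ = _ := by rw [coeffBound, mul_pow]

/-- Solutions in a number field `ℚ(α)` with `α` integral: for a root `y` of an equation with leading
coefficient `l(α)`, the element `w = l(α) y` is integral and of bounded size, hence
`w μ'(α) = W(α)` for an integer polynomial `W` with bounded coefficients. -/
lemma isBoxFraction_of_root_numberField {s : ℕ} (pb : PowerBasis ℚ K)
    (hα : IsIntegral ℤ pb.gen) (hμ : SmallPoly s (minpoly ℤ pb.gen)) {q : ℤ[X][X]}
    (hs : SmallPoly₂ s q) {y : K} (hq : q.map (evalAt pb.gen) ≠ 0)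
    (hy : q.eval₂ (evalAt pb.gen) y = 0) : IsBoxFraction s pb.gen y := by
  set α := pb.gen with hαdef
  set μ := minpoly ℤ α with hμdef
  have hμQ : minpoly ℚ α = μ.map (Int.castRingHom ℚ) :=
    minpoly.isIntegrallyClosed_eq_field_fractions' ℚ hα
  have hmonic : μ.Monic := minpoly.monic hα
  have hdim : pb.dim = μ.natDegree := by
    rw [← pb.natDegree_minpoly, ← hαdef, hμQ, hmonic.natDegree_map]
  set f := q.map (evalAt α) with hf
  set l := q.coeff f.natDegree with hl
  have hlα : evalAt α l = f.leadingCoeff := by rw [leadingCoeff, hf, coeff_map]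
  set w := evalAt α l * y with hw
  have hσ : ∀ (σ : K →ₐ[ℚ] ℂ) (g : ℤ[X]),
      σ (evalAt α g) = g.eval₂ (Int.castRingHom ℂ) (σ α) := fun σ g => by
    have := hom_eval₂ g (Int.castRingHom K) (σ : K →+* ℂ) α
    rwa [RingHom.ext_int ((σ : K →+* ℂ).comp (Int.castRingHom K)) (Int.castRingHom ℂ)] at this
  -- the leading coefficient times a root is integral over the ring of integers `O`, hence over `ℤ`
  have hwint : IsIntegral ℤ w := by
    let O := integralClosure ℤ K
    let ev : ℤ[X] →+* O := eval₂RingHom (Int.castRingHom O) ⟨α, hα⟩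
    have hev : (algebraMap O K).comp ev = evalAt α := by
      ext
      · simp [ev]
      · simp only [ev, RingHom.comp_apply, coe_eval₂RingHom, eval₂_X]
        rfl
    have hmap : (q.map ev).map (algebraMap O K) = f := by rw [map_map, hev]
    have hinj : Function.Injective (algebraMap O K) := Subtype.val_injective
    have h1 := isIntegral_leadingCoeff_smul (q.map ev) y (by
      rw [aeval_def, eval₂_map, hev, hy])
    have h2 : (q.map ev).leadingCoeff • y = w := by
      rw [Algebra.smul_def, ← leadingCoeff_map_of_injective hinj, hmap, hw, hlα]
    rw [h2] at h1
    exact isIntegral_trans (R := ℤ) (A := O) w h1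
  have hb : ∀ i, IsIntegral ℤ ((minpolyDiv ℚ α).coeff i) := by
    intro i
    rw [← minpolyDiv_eq_of_isIntegrallyClosed (R := ℤ) (K := ℚ) hα]
    exact adjoin_le_integralClosure hα (coeff_minpolyDiv_mem_adjoin (R := ℤ) α i)
  -- the coefficients of `W` are traces of integral elements
  have htr : ∀ i, ∃ n : ℤ, (n : ℚ) = Algebra.trace ℚ K (w * (minpolyDiv ℚ α).coeff i) := fun i => by
    have := Algebra.isIntegral_trace (R := ℤ) (L := ℚ) (F := K) (hwint.mul (hb i))
    simpa using IsIntegrallyClosed.isIntegral_iff.1 this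
  choose n hn using htr
  -- all factors of the traces are bounded at every complex embedding
  have hroot : ∀ σ : K →ₐ[ℚ] ℂ, ‖σ α‖ ≤ s + 1 := fun σ => hμ.norm_root_le hmonic (by
    have h1 : evalAt α μ = 0 := by
      have := minpoly.aeval ℤ α
      rwa [aeval_def] at this
    rw [← hσ, h1, map_zero])
  have hwσ : ∀ σ : K →ₐ[ℚ] ℂ, ‖σ w‖ ≤ 2 * ((s + 1) * (s * (s + 1) ^ s)) := by
    intro σ
    have h1 := norm_leadingCoeff_mul_root_le (f := f.map (σ : K →+* ℂ))
      ((Polynomial.map_ne_zero_iff (σ : K →+* ℂ).injective).2 hq) (z := σ y) (by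
        rw [← RingHom.coe_coe σ, eval_map_apply, eval_map, hy, map_zero])
      (B := (s + 1) * (s * (s + 1) ^ s)) (fun j => by
        rw [hf, coeff_map, coeff_map, RingHom.coe_coe, hσ]
        exact (hs j).norm_eval_le (hroot σ))
    rwa [leadingCoeff_map, RingHom.coe_coe, ← map_mul, ← hlα] at h1
  have hbσ : ∀ (σ : K →ₐ[ℚ] ℂ) (i : ℕ),
      ‖σ ((minpolyDiv ℚ α).coeff i)‖ ≤ 2 ^ s * ((s + 1) * s) := by
    intro σ i
    have h1 : (minpolyDiv ℚ α).map (σ : K →+* ℂ) * (X - C (σ α)) =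
        μ.map (Int.castRingHom ℂ) := by
      have := congrArg (Polynomial.map (σ : K →+* ℂ)) (minpolyDiv_spec ℚ α)
      rw [Polynomial.map_mul, hμQ, map_map, map_map, Polynomial.map_sub, map_X, map_C] at this
      rw [← RingHom.ext_int (((σ : K →+* ℂ).comp (algebraMap ℚ K)).comp (Int.castRingHom ℚ))
        (Int.castRingHom ℂ)]
      exact this
    have h2 := hμ.norm_coeff_le h1 ?_ ?_ i
    · simpa using h2
    · have := natDegree_minpolyDiv_lt (R := ℚ) (x := α) hα.tower_top
      have h3 : (minpoly ℚ α).natDegree = μ.natDegree := by rw [hμQ, hmonic.natDegree_map]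
      have h4 := natDegree_map_le (f := (σ : K →+* ℂ)) (p := minpolyDiv ℚ α)
      have := hμ.1
      omega
    · rw [mahlerMeasure_X_sub_C]
      exact le_max_left _ _
  have hdims : pb.dim ≤ s := hdim ▸ hμ.1
  have hnb : ∀ i, (n i).natAbs ≤ coeffBound s := by
    intro i
    refine le_trans ?_ (trace_bound_le_coeffBound s)
    have h1 := trace_eq_sum_embeddings (K := ℚ) (L := K) ℂ (x := w * (minpolyDiv ℚ α).coeff i)
    rw [← hn] at h1
    have h2 : ‖((n i : ℚ) : ℂ)‖ ≤
        s * (2 * ((s + 1) * (s * (s + 1) ^ s)) * (2 ^ s * ((s + 1) * s))) := by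
      rw [eq_ratCast] at h1
      rw [h1]
      refine (norm_sum_le _ _).trans ((Finset.sum_le_card_nsmul _ _
        ((2 * ((s + 1) * (s * (s + 1) ^ s)) * (2 ^ s * ((s + 1) * s))) : ℝ) fun σ _ => ?_).trans ?_)
      · rw [map_mul, norm_mul]
        exact mul_le_mul (hwσ σ) (hbσ σ i) (norm_nonneg _) (by positivity)
      · rw [Finset.card_univ, AlgHom.card, pb.finrank, nsmul_eq_mul]
        gcongr
    rw [Rat.cast_intCast, Complex.norm_intCast, ← Int.cast_abs, Int.abs_eq_natAbs] at h2
    exact_mod_cast h2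
  have hδ : evalAt α (derivative μ) = aeval α (derivative (minpoly ℚ α)) := by
    rw [hμQ, derivative_map, aeval_def, eval₂_map, RingHom.ext_int ((algebraMap ℚ K).comp
      (Int.castRingHom ℚ)) (Int.castRingHom K)]
    rfl
  have hδ0 : evalAt α (derivative μ) ≠ 0 := by
    rw [hδ]
    exact (Algebra.IsSeparable.isSeparable ℚ α).aeval_derivative_ne_zero (minpoly.aeval _ _)
  refine ⟨∑ i : Fin pb.dim, C (n i) * X ^ (i : ℕ), l * derivative μ, ⟨?_, ?_⟩,
    (hs _).inBox_mul_derivative hμ, ?_, ?_⟩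
  · refine natDegree_sum_le_of_forall_le _ _ fun i _ => (natDegree_C_mul_X_pow_le _ _).trans ?_
    omega
  · intro j
    rw [finsetSum_coeff]
    simp only [coeff_C_mul, coeff_X_pow, mul_ite, mul_one, mul_zero]
    by_cases hj : j < pb.dim
    · rw [Finset.sum_eq_single (⟨j, hj⟩ : Fin pb.dim)]
      · simpa using hnb j
      · intro i _ hi
        rw [if_neg]
        rintro rfl
        exact hi rfl
      · simp
    · rw [Finset.sum_eq_zero]
      · simp
      · intro i _
        rw [if_neg]
        have := i.2
        omega
  · rw [map_mul, hlα]
    exact mul_ne_zero (leadingCoeff_ne_zero.2 hq) hδ0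
  · rw [map_mul, ← mul_assoc, mul_comm y, ← hw, hδ, mul_derivative_eq_sum pb w, map_sum]
    refine Finset.sum_congr rfl fun i _ => ?_
    rw [map_mul, map_pow, ← hn, Algebra.smul_def]
    simp [hαdef]

end NumberField

/-! ### Computable polynomial rings -/

/-- Primitive recursive ring operations on a type `R` of codes for elements of `S`; an element of
`S` may have several codes. -/
class CompRing (R : Type) (S : outParam Type) [Primcodable R] [CommRing S] where
  /-- The element with the given code. -/
  val : R → S
  /-- A code of `0`. -/
  zero : R
  /-- A code of `1`. -/
  one : R
  /-- Addition of codes. -/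
  add : R → R → R
  /-- Negation of codes. -/
  neg : R → R
  /-- Multiplication of codes. -/
  mul : R → R → R
  val_zero : val zero = 0
  val_one : val one = 1
  val_add : ∀ a b, val (add a b) = val a + val b
  val_neg : ∀ a, val (neg a) = -val a
  val_mul : ∀ a b, val (mul a b) = val a * val b
  primrec_add : Primrec₂ add
  primrec_neg : Primrec neg
  primrec_mul : Primrec₂ mul

namespace CompRing

attribute [simp] val_zero val_one val_add val_neg val_mul

/-- Integers are coded as differences of natural numbers. -/
instance : CompRing (ℕ × ℕ) ℤ where
  val a := a.1 - a.2
  zero := (0, 0)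
  one := (1, 0)
  add a b := (a.1 + b.1, a.2 + b.2)
  neg a := (a.2, a.1)
  mul a b := (a.1 * b.1 + a.2 * b.2, a.1 * b.2 + a.2 * b.1)
  val_zero := by simp
  val_one := by simp
  val_add a b := by push_cast; ring
  val_neg a := by ring
  val_mul a b := by push_cast; ring
  primrec_add := Primrec.pair
    (Primrec.nat_add.comp (Primrec.fst.comp .fst) (Primrec.fst.comp .snd))
    (Primrec.nat_add.comp (Primrec.snd.comp .fst) (Primrec.snd.comp .snd))
  primrec_neg := .pair .snd .fst
  primrec_mul := Primrec.pair
    (Primrec.nat_add.comp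
      (Primrec.nat_mul.comp (Primrec.fst.comp .fst) (Primrec.fst.comp .snd))
      (Primrec.nat_mul.comp (Primrec.snd.comp .fst) (Primrec.snd.comp .snd)))
    (Primrec.nat_add.comp
      (Primrec.nat_mul.comp (Primrec.fst.comp .fst) (Primrec.snd.comp .snd))
      (Primrec.nat_mul.comp (Primrec.snd.comp .fst) (Primrec.fst.comp .snd)))

lemma val_int (a : ℕ × ℕ) : val a = (a.1 : ℤ) - a.2 := rfl

section List

variable {R S : Type} [Primcodable R] [CommRing S] [CompRing R S]

/-- The polynomial with the given list of coefficients, constant coefficient first. -/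
noncomputable def listVal (l : List R) : S[X] := l.foldr (fun c f => C (val c) + X * f) 0

lemma coeff_listVal (l : List R) (i : ℕ) : (listVal l).coeff i = val (l.getD i zero) := by
  induction l generalizing i with
  | nil => simp [listVal]
  | cons c l ih =>
    have h : listVal (c :: l) = C (val c) + X * listVal l := rfl
    cases i with
    | zero => simp [h]
    | succ i => simp [h, coeff_X_mul, ih, coeff_C_succ]

/-- Addition of lists of coefficients. -/
def listAdd (a b : List R) : List R :=
  (List.range (max a.length b.length)).map fun i => add (a.getD i zero) (b.getD i zero)

/-- Multiplication of lists of coefficients. -/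
def listMul (a b : List R) : List R :=
  a.foldr (fun c l => listAdd (b.map (mul c)) (zero :: l)) []

lemma getD_map_range {f : ℕ → R} {n i : ℕ} :
    ((List.range n).map f).getD i zero = if i < n then f i else zero := by
  split_ifs with h <;> simp [List.getD_eq_getElem?_getD, h]

lemma listVal_add (a b : List R) : listVal (listAdd a b) = listVal a + listVal b := by
  ext i
  rw [coeff_add, coeff_listVal, coeff_listVal, coeff_listVal, listAdd, getD_map_range]
  split_ifs with h
  · simp
  · rw [List.getD_eq_default _ _ (by omega), List.getD_eq_default _ _ (by omega)]
    simp

lemma listVal_map (f : R → R) (g : S → S) (h : ∀ c, val (f c) = g (val c)) (hg : g 0 = 0)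
    (l : List R) (i : ℕ) : (listVal (l.map f)).coeff i = g ((listVal l).coeff i) := by
  rw [coeff_listVal, coeff_listVal]
  by_cases hi : i < l.length
  · simp [List.getD_eq_getElem?_getD, hi, h]
  · rw [List.getD_eq_default _ _ (by simpa using hi), List.getD_eq_default _ _ (by simpa using hi)]
    simp [hg]

lemma listVal_cons (c : R) (l : List R) : listVal (c :: l) = C (val c) + X * listVal l := rfl

lemma listVal_mul (a b : List R) : listVal (listMul a b) = listVal a * listVal b := by
  induction a with
  | nil => simp [listVal, listMul]
  | cons c a ih =>
    have h1 : listMul (c :: a) b = listAdd (b.map (mul c)) (zero :: listMul a b) := rfl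
    have h2 : listVal (b.map (mul c)) = C (val c) * listVal b := by
      ext i
      rw [listVal_map _ (fun x => val c * x) (by simp) (by simp), coeff_C_mul]
    rw [h1, listVal_add, h2, listVal_cons, listVal_cons, ih]
    simp
    ring

lemma primrec_listAdd : Primrec₂ (listAdd (R := R)) := by
  refine Primrec.list_map (Primrec.list_range.comp (Primrec.nat_max.comp
    (Primrec.list_length.comp .fst) (Primrec.list_length.comp .snd))) ?_
  exact primrec_add.comp
    ((Primrec.list_getD _).comp (Primrec.fst.comp .fst) .snd)
    ((Primrec.list_getD _).comp (Primrec.snd.comp .fst) .snd)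

lemma primrec_listMul : Primrec₂ (listMul (R := R)) := by
  refine Primrec.list_foldr (f := fun x : List R × List R => x.1) (g := fun _ => [])
    (h := fun x y => listAdd (x.2.map (mul y.1)) (zero :: y.2)) .fst (.const []) ?_
  refine primrec_listAdd.comp (Primrec.list_map (Primrec.snd.comp .fst) ?_)
    (Primrec.list_cons.comp (.const _) (Primrec.snd.comp .snd))
  exact primrec_mul.comp (Primrec.fst.comp (Primrec.snd.comp .fst)) .snd

/-- Polynomials over `S` are coded by lists of coefficients. -/
noncomputable instance : CompRing (List R) S[X] where
  val := listVal
  zero := []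
  one := [one]
  add := listAdd
  neg l := l.map neg
  mul := listMul
  val_zero := rfl
  val_one := by simp [listVal]
  val_add := listVal_add
  val_neg l := by
    ext i
    rw [listVal_map _ (fun x => -x) (by simp) (by simp), coeff_neg]
  val_mul := listVal_mul
  primrec_add := primrec_listAdd
  primrec_neg := Primrec.list_map .id (primrec_neg.comp .snd)
  primrec_mul := primrec_listMul

lemma val_nil : val ([] : List R) = 0 := rfl

lemma val_cons (c : R) (l : List R) : val (c :: l) = C (val c) + X * val l := rfl

lemma coeff_val (l : List R) (i : ℕ) : (val l).coeff i = val (l.getD i zero) := coeff_listVal l i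

lemma coeff_val_eq_zero {l : List R} {i : ℕ} (h : l.length ≤ i) : (val l).coeff i = 0 := by
  rw [coeff_val, List.getD_eq_default _ _ h, val_zero]

lemma exists_val_eq (hR : Function.Surjective (val : R → S)) :
    Function.Surjective (val : List R → S[X]) := by
  choose g hg using hR
  intro f
  refine ⟨(List.range (f.natDegree + 1)).map fun i => g (f.coeff i), ?_⟩
  ext i
  rw [coeff_val, getD_map_range]
  split_ifs with h
  · exact hg _
  · rw [val_zero, coeff_eq_zero_of_natDegree_lt (by omega)]

/-- All coefficients satisfy a predicate that holds for `0`. -/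
lemma forall_coeff_val {l : List R} {p : S → Prop} (h0 : p 0) :
    (∀ i, p ((val l).coeff i)) ↔ ∀ c ∈ l, p (val c) := by
  constructor
  · intro h c hc
    obtain ⟨i, hi, rfl⟩ := List.mem_iff_getElem.1 hc
    have := h i
    rwa [coeff_val, List.getD_eq_getElem _ _ hi] at this
  · intro h i
    rw [coeff_val]
    by_cases hi : i < l.length
    · rw [List.getD_eq_getElem _ _ hi]
      exact h _ (List.getElem_mem hi)
    · rw [List.getD_eq_default _ _ (by omega), val_zero]
      exact h0

/-- Powers. -/
def pow (a : R) (n : ℕ) : R := Nat.rec one (fun _ b => mul b a) n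

@[simp]
lemma val_pow (a : R) (n : ℕ) : val (pow a n) = val a ^ n := by
  induction n with
  | zero => simp [pow]
  | succ n ih =>
    have : pow a (n + 1) = mul (pow a n) a := rfl
    rw [this, val_mul, ih, pow_succ]

lemma primrec_pow : Primrec₂ (pow : R → ℕ → R) :=
  Primrec.nat_rec (f := fun _ => one) (g := fun a x => mul x.2 a) (.const _)
    (primrec_mul.comp (Primrec.snd.comp .snd) .fst)

/-- Linear combinations; missing coefficients count as `0`. -/
def comb (cs gs : List R) : R :=
  (List.range gs.length).foldr (fun i r => add (mul (cs.getD i zero) (gs.getD i zero)) r) zero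

lemma val_comb (cs gs : List R) : val (comb cs gs) =
    ∑ i ∈ Finset.range gs.length, val (cs.getD i zero) * val (gs.getD i zero) := by
  have key (l : List ℕ) :
      val (l.foldr (fun i r => add (mul (cs.getD i zero) (gs.getD i zero)) r) zero) =
      (l.map fun i => val (cs.getD i zero) * val (gs.getD i zero)).sum := by
    induction l with
    | nil => simp
    | cons i l ih => rw [List.foldr_cons, val_add, val_mul, ih, List.map_cons, List.sum_cons]
  rw [comb, key]
  rfl

lemma primrec_comb : Primrec₂ (comb : List R → List R → R) := by
  refine Primrec.list_foldr (f := fun x : List R × List R => List.range x.2.length)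
    (g := fun _ => zero)
    (h := fun x y => add (mul (x.1.getD y.1 zero) (x.2.getD y.1 zero)) y.2)
    (Primrec.list_range.comp (Primrec.list_length.comp .snd)) (.const _) ?_
  refine primrec_add.comp (primrec_mul.comp ?_ ?_) (Primrec.snd.comp .snd)
  · exact (Primrec.list_getD _).comp (Primrec.fst.comp .fst) (Primrec.fst.comp .snd)
  · exact (Primrec.list_getD _).comp (Primrec.snd.comp .fst) (Primrec.fst.comp .snd)

lemma val_comb_mem_span (cs gs : List R) :
    val (comb cs gs) ∈ Ideal.span {g | g ∈ gs.map val} := by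
  rw [val_comb]
  refine Ideal.sum_mem _ fun i hi => Ideal.mul_mem_left _ _ (Ideal.subset_span ?_)
  rw [Finset.mem_range] at hi
  rw [List.getD_eq_getElem _ _ hi]
  exact List.mem_map_of_mem (List.getElem_mem hi)

lemma exists_val_comb (hR : Function.Surjective (val : R → S)) (gs : List R) {x : S}
    (hx : x ∈ Ideal.span {g | g ∈ gs.map val}) : ∃ cs, val (comb cs gs) = x := by
  suffices h : ∃ f : ℕ → S, ∑ i ∈ Finset.range gs.length, f i * val (gs.getD i zero) = x by
    obtain ⟨f, rfl⟩ := h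
    choose c hc using hR
    refine ⟨(List.range gs.length).map fun i => c (f i), ?_⟩
    rw [val_comb]
    refine Finset.sum_congr rfl fun i hi => ?_
    rw [getD_map_range, if_pos (Finset.mem_range.1 hi), hc]
  induction hx using Submodule.span_induction with
  | mem x hx =>
    obtain ⟨g, hg, rfl⟩ := List.mem_map.1 hx
    obtain ⟨i, hi, rfl⟩ := List.mem_iff_getElem.1 hg
    refine ⟨fun j => if j = i then 1 else 0, ?_⟩
    simp only [ite_mul, one_mul, zero_mul, Finset.sum_ite_eq', Finset.mem_range, hi, if_true]
    rw [List.getD_eq_getElem _ _ hi]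
  | zero => exact ⟨0, by simp⟩
  | add x y _ _ hx hy =>
    obtain ⟨f, rfl⟩ := hx
    obtain ⟨g, rfl⟩ := hy
    exact ⟨f + g, by simp only [Pi.add_apply, add_mul, Finset.sum_add_distrib]⟩
  | smul a x _ hx =>
    obtain ⟨f, rfl⟩ := hx
    exact ⟨fun i => a * f i, by simp only [mul_assoc, smul_eq_mul, Finset.mul_sum]⟩

end List

end CompRing

open CompRing

/-! ### Disjunctive normal forms -/

section CourseOfValues

variable {σ : Type}

/-- The values at `0, …, n - 1` of the function defined by course-of-values recursion. -/
def courseTable (step : ℕ → List σ → σ) : ℕ → List σ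
  | 0 => []
  | n + 1 => courseTable step n ++ [step n (courseTable step n)]

/-- The function `f` with `f n = step n [f 0, …, f (n - 1)]`. -/
def courseRec (step : ℕ → List σ → σ) (n : ℕ) : σ := step n (courseTable step n)

lemma courseTable_getD (step : ℕ → List σ → σ) (n j : ℕ) (d : σ) :
    (courseTable step n).getD j d = if j < n then courseRec step j else d := by
  have h : courseTable step n = (List.range n).map (courseRec step) := by
    induction n with
    | zero => rfl
    | succ n ih =>
      rw [List.range_succ, List.map_append, ← ih]
      rfl
  rw [h]
  split_ifs with h <;> simp [List.getD_eq_getElem?_getD, h]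

lemma primrec_courseRec [Primcodable σ] {step : ℕ → List σ → σ} (h : Primrec₂ step) :
    Primrec (courseRec step) := by
  have h1 : Primrec (courseTable step) := by
    refine (Primrec.nat_rec₁ (f := fun n l => l ++ [step n l]) [] ?_).of_eq fun n => ?_
    · exact Primrec.list_concat.comp .snd h
    · induction n with
      | zero => rfl
      | succ n ih => rw [courseTable, ← ih]
  exact h.comp .id h1

end CourseOfValues

/-- Codes for polynomials in `ℤ[x]`. -/
abbrev PolyCode := List (ℕ × ℕ)

/-- Codes for polynomials in `ℤ[x][y]`. -/
abbrev PolyCode₂ := List PolyCode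

/-- One step in the computation of the polynomial of a term in `x = x₀` and `y = x₁`, given the
results for smaller codes. -/
noncomputable def termStep (k : ℕ) (l : List (Option PolyCode₂)) : Option PolyCode₂ :=
  if k.unpair.1 = 0 then
    if k.unpair.2 = 0 then some [ [(0, 0), (1, 0)] ]
    else if k.unpair.2 = 1 then some [ [], [(1, 0)] ] else none
  else if k.unpair.1 = 1 then
    if k.unpair.2 = 0 then some zero else if k.unpair.2 = 1 then some one else none
  else if k.unpair.1 = 2 then (l.getD k.unpair.2 none).map neg
  else if k.unpair.1 = 3 then
    (l.getD k.unpair.2.unpair.1 none).bind fun a => (l.getD k.unpair.2.unpair.2 none).map (add a)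
  else if k.unpair.1 = 4 then
    (l.getD k.unpair.2.unpair.1 none).bind fun a => (l.getD k.unpair.2.unpair.2 none).map (mul a)
  else none

/-- The polynomial of the term with the given Gödel number; `none` if there is no such term. -/
noncomputable def termPoly : ℕ → Option PolyCode₂ := courseRec termStep

/-- Disjunctions of clauses, in codes. -/
abbrev DNFCode := List (List PolyCode₂ × PolyCode₂)

/-- The conjunction of two disjunctions of clauses. -/
noncomputable def dnfAnd (Φ Ψ : DNFCode) : DNFCode :=
  Φ.flatMap fun c => Ψ.map fun d => (c.1 ++ d.1, mul c.2 d.2)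

/-- One step in the computation of disjunctive normal forms of a quantifier-free formula and of its
negation, given the results for smaller codes. -/
noncomputable def formulaStep (k : ℕ) (l : List (Option (DNFCode × DNFCode))) :
    Option (DNFCode × DNFCode) :=
  if k.unpair.1 = 0 then if k.unpair.2 = 0 then some ([], [([], one)]) else none
  else if k.unpair.1 = 1 then
    (termPoly k.unpair.2.unpair.1).bind fun a => (termPoly k.unpair.2.unpair.2).map fun b =>
      ([([add a (neg b)], one)], [([], add a (neg b))])
  else if k.unpair.1 = 2 then
    (l.getD k.unpair.2.unpair.1 none).bind fun a => (l.getD k.unpair.2.unpair.2 none).map fun b =>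
      (a.2 ++ b.1, dnfAnd a.1 b.2)
  else none

/-- Disjunctive normal forms of the quantifier-free formula with the given Gödel number and of its
negation; `none` if there is no such formula. -/
noncomputable def formulaDNF : ℕ → Option (DNFCode × DNFCode) := courseRec formulaStep

/-- The Gödel number of `∀ x ∃ y, ψ` for the formula `ψ` with Gödel number `m`. -/
def forallExistsCode (m : ℕ) : ℕ :=
  Nat.pair 3 (Nat.pair 2 (Nat.pair (Nat.pair 3 (Nat.pair 2 (Nat.pair m (Nat.pair 0 0))))
    (Nat.pair 0 0)))

/-- The Gödel number of `ψ`, given that of `∀ x ∃ y, ψ`. -/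
def matrixCode (k : ℕ) : ℕ := k.unpair.2.unpair.2.unpair.1.unpair.2.unpair.2.unpair.1

/-- A disjunctive normal form of `ψ`, for the Gödel number of a sentence `∀ x ∃ y, ψ`; `none` if the
number does not have this form. -/
noncomputable def sentenceDNF (k : ℕ) : Option DNFCode :=
  if forallExistsCode (matrixCode k) = k then (formulaDNF (matrixCode k)).map Prod.fst else none

section Primrec

lemma primrec_termStep : Primrec₂ termStep := by
  have t : Primrec fun x : ℕ × List (Option PolyCode₂) => x.1.unpair.1 :=
    Primrec.fst.comp (Primrec.unpair.comp .fst)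
  have r : Primrec fun x : ℕ × List (Option PolyCode₂) => x.1.unpair.2 :=
    Primrec.snd.comp (Primrec.unpair.comp .fst)
  have teq (n : ℕ) : PrimrecPred fun x : ℕ × List (Option PolyCode₂) => x.1.unpair.1 = n :=
    Primrec.eq.comp t (.const n)
  have req (n : ℕ) : PrimrecPred fun x : ℕ × List (Option PolyCode₂) => x.1.unpair.2 = n :=
    Primrec.eq.comp r (.const n)
  have l0 : Primrec fun x : ℕ × List (Option PolyCode₂) => x.2.getD x.1.unpair.2 none :=
    (Primrec.list_getD none).comp .snd r
  have l1 : Primrec fun x : ℕ × List (Option PolyCode₂) =>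
      x.2.getD x.1.unpair.2.unpair.1 none :=
    (Primrec.list_getD none).comp .snd (Primrec.fst.comp (Primrec.unpair.comp r))
  have l2 : Primrec fun x : ℕ × List (Option PolyCode₂) =>
      x.2.getD x.1.unpair.2.unpair.2 none :=
    (Primrec.list_getD none).comp .snd (Primrec.snd.comp (Primrec.unpair.comp r))
  refine Primrec.ite (teq 0) (.ite (req 0) (.const _) (.ite (req 1) (.const _) (.const _)))
    (.ite (teq 1) (.ite (req 0) (.const _) (.ite (req 1) (.const _) (.const _)))
    (.ite (teq 2) (Primrec.option_map l0 (primrec_neg.comp .snd))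
    (.ite (teq 3) (Primrec.option_bind l1 (Primrec.option_map (l2.comp .fst) ?_))
    (.ite (teq 4) (Primrec.option_bind l1 (Primrec.option_map (l2.comp .fst) ?_)) (.const _)))))
  · exact primrec_add.comp (Primrec.snd.comp .fst) .snd
  · exact primrec_mul.comp (Primrec.snd.comp .fst) .snd

lemma primrec_termPoly : Primrec termPoly := primrec_courseRec primrec_termStep

lemma primrec_dnfAnd : Primrec₂ dnfAnd := by
  refine Primrec.list_flatMap .fst (Primrec.list_map (Primrec.snd.comp .fst) ?_)
  refine Primrec.pair (Primrec.list_append.comp ?_ ?_) (primrec_mul.comp ?_ ?_)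
  · exact Primrec.fst.comp (Primrec.snd.comp .fst)
  · exact Primrec.fst.comp .snd
  · exact Primrec.snd.comp (Primrec.snd.comp .fst)
  · exact Primrec.snd.comp .snd

lemma primrec_formulaStep : Primrec₂ formulaStep := by
  have t : Primrec fun x : ℕ × List (Option (DNFCode × DNFCode)) => x.1.unpair.1 :=
    Primrec.fst.comp (Primrec.unpair.comp .fst)
  have r : Primrec fun x : ℕ × List (Option (DNFCode × DNFCode)) => x.1.unpair.2 :=
    Primrec.snd.comp (Primrec.unpair.comp .fst)
  have teq (n : ℕ) : PrimrecPred fun x : ℕ × List (Option (DNFCode × DNFCode)) =>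
      x.1.unpair.1 = n :=
    Primrec.eq.comp t (.const n)
  have r1 : Primrec fun x : ℕ × List (Option (DNFCode × DNFCode)) => x.1.unpair.2.unpair.1 :=
    Primrec.fst.comp (Primrec.unpair.comp r)
  have r2 : Primrec fun x : ℕ × List (Option (DNFCode × DNFCode)) => x.1.unpair.2.unpair.2 :=
    Primrec.snd.comp (Primrec.unpair.comp r)
  have sub : Primrec fun x : ((ℕ × List (Option (DNFCode × DNFCode))) × PolyCode₂) × PolyCode₂ =>
      add x.1.2 (neg x.2) :=
    primrec_add.comp (Primrec.snd.comp .fst) (primrec_neg.comp .snd)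
  refine Primrec.ite (teq 0) (.ite (Primrec.eq.comp r (.const 0)) (.const _) (.const _))
    (.ite (teq 1) (Primrec.option_bind (primrec_termPoly.comp r1)
      (Primrec.option_map (primrec_termPoly.comp (r2.comp .fst)) ?_))
    (.ite (teq 2) (Primrec.option_bind ((Primrec.list_getD none).comp .snd r1)
      (Primrec.option_map ((Primrec.list_getD none).comp (Primrec.snd.comp .fst)
        (r2.comp .fst)) ?_))
      (.const _)))
  · refine Primrec.pair ?_ ?_
    · exact Primrec.list_cons.comp
        (Primrec.pair (Primrec.list_cons.comp sub (.const [])) (.const _)) (.const [])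
    · exact Primrec.list_cons.comp (Primrec.pair (.const []) sub) (.const [])
  · refine Primrec.pair (Primrec.list_append.comp ?_ ?_) (primrec_dnfAnd.comp ?_ ?_)
    · exact Primrec.snd.comp (Primrec.snd.comp .fst)
    · exact Primrec.fst.comp .snd
    · exact Primrec.fst.comp (Primrec.snd.comp .fst)
    · exact Primrec.snd.comp .snd

lemma primrec_formulaDNF : Primrec formulaDNF := primrec_courseRec primrec_formulaStep

lemma primrec_sentenceDNF : Primrec sentenceDNF := by
  have u1 : Primrec fun n : ℕ => n.unpair.1 := Primrec.fst.comp Primrec.unpair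
  have u2 : Primrec fun n : ℕ => n.unpair.2 := Primrec.snd.comp Primrec.unpair
  have hm : Primrec matrixCode := u1.comp (u2.comp (u2.comp (u1.comp (u2.comp u2))))
  have p {f g : ℕ → ℕ} (hf : Primrec f) (hg : Primrec g) : Primrec fun n => Nat.pair (f n) (g n) :=
    Primrec₂.natPair.comp hf hg
  have hc : Primrec forallExistsCode :=
    p (.const 3) (p (.const 2) (p (p (.const 3) (p (.const 2) (p .id (.const _)))) (.const _)))
  exact Primrec.ite (Primrec.eq.comp (hc.comp hm) .id)
    (Primrec.option_map (primrec_formulaDNF.comp hm) (Primrec.fst.comp .snd)) (.const none)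

end Primrec

/-! ### Semantics of the normal forms -/

/-- The clause with the given code. -/
noncomputable def clauseVal (c : List PolyCode₂ × PolyCode₂) : Clause := (c.1.map val, val c.2)

lemma lt_pair {a : ℕ} (ha : 0 < a) (b : ℕ) : b < Nat.pair a b := by
  rw [Nat.pair]
  split_ifs with h
  · nlinarith
  · nlinarith

lemma termPoly_eq (k : ℕ) : termPoly k = termStep k (courseTable termStep k) := rfl

lemma formulaDNF_eq (k : ℕ) : formulaDNF k = formulaStep k (courseTable formulaStep k) := rfl

lemma courseTable_termStep_getD (k j : ℕ) :
    (courseTable termStep k).getD j none = if j < k then termPoly j else none :=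
  courseTable_getD _ _ _ _

lemma courseTable_formulaStep_getD (k j : ℕ) :
    (courseTable formulaStep k).getD j none = if j < k then formulaDNF j else none :=
  courseTable_getD _ _ _ _

lemma pair_args_lt {a : ℕ} (ha : 0 < a) (b c : ℕ) :
    b < Nat.pair a (Nat.pair b c) ∧ c < Nat.pair a (Nat.pair b c) :=
  ⟨(Nat.left_le_pair b c).trans_lt (lt_pair ha _), (Nat.right_le_pair b c).trans_lt (lt_pair ha _)⟩

lemma termPoly_neg (n : ℕ) : termPoly (Nat.pair 2 n) = (termPoly n).map neg := by
  rw [termPoly_eq, termStep, courseTable_termStep_getD]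
  simp [lt_pair]

lemma termPoly_add (m n : ℕ) : termPoly (Nat.pair 3 (Nat.pair m n)) =
    (termPoly m).bind fun a => (termPoly n).map (add a) := by
  rw [termPoly_eq, termStep]
  simp only [Nat.unpair_pair, courseTable_termStep_getD, (pair_args_lt three_pos m n).1,
    (pair_args_lt three_pos m n).2]
  simp

lemma termPoly_mul (m n : ℕ) : termPoly (Nat.pair 4 (Nat.pair m n)) =
    (termPoly m).bind fun a => (termPoly n).map (mul a) := by
  rw [termPoly_eq, termStep]
  simp only [Nat.unpair_pair, courseTable_termStep_getD, (pair_args_lt four_pos m n).1,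
    (pair_args_lt four_pos m n).2]
  simp

lemma formulaDNF_imp (m n : ℕ) : formulaDNF (Nat.pair 2 (Nat.pair m n)) =
    (formulaDNF m).bind fun a => (formulaDNF n).map fun b => (a.2 ++ b.1, dnfAnd a.1 b.2) := by
  rw [formulaDNF_eq, formulaStep, courseTable_formulaStep_getD, courseTable_formulaStep_getD]
  simp [pair_args_lt]

lemma formulaDNF_equal (m n : ℕ) : formulaDNF (Nat.pair 1 (Nat.pair m n)) =
    (termPoly m).bind fun a => (termPoly n).map fun b =>
      ([([add a (neg b)], one)], [([], add a (neg b))]) := by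
  rw [formulaDNF_eq, formulaStep]
  simp

lemma formulaDNF_falsum : formulaDNF (Nat.pair 0 0) = some ([], [([], one)]) := by
  rw [formulaDNF_eq, formulaStep]
  simp

lemma termPoly_termCode (t : Language.ring.Term (Empty ⊕ Fin 2)) :
    ∃ q, termPoly (termCode t) = some q ∧ ∀ (K : Type u) [Field K] (xs : Fin 2 → K),
      (val q).eval₂ (evalAt (xs 0)) (xs 1) =
        letI := Ring.compatibleRingOfRing K
        t.realize (Sum.elim default xs) := by
  induction t with
  | var v =>
    rcases v with e | i
    · exact e.elim
    · fin_cases i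
      · refine ⟨_, rfl, fun K _ xs => ?_⟩
        simp [val_cons, val_nil, val_int]
      · refine ⟨_, rfl, fun K _ xs => ?_⟩
        simp [val_cons, val_nil, val_int]
  | func f ts ih =>
    cases f with
    | zero =>
      refine ⟨zero, by simp [termCode, termPoly_eq, termStep], fun K _ xs => ?_⟩
      let := Ring.compatibleRingOfRing K
      rw [val_zero, eval₂_zero]
      exact (Ring.CompatibleRing.funMap_zero _).symm
    | one =>
      refine ⟨one, by simp [termCode, termPoly_eq, termStep], fun K _ xs => ?_⟩
      let := Ring.compatibleRingOfRing K
      rw [val_one, eval₂_one]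
      exact (Ring.CompatibleRing.funMap_one _).symm
    | neg =>
      obtain ⟨q, hq, h⟩ := ih 0
      refine ⟨neg q, by rw [termCode, termPoly_neg, hq]; rfl, fun K _ xs => ?_⟩
      let := Ring.compatibleRingOfRing K
      rw [val_neg, eval₂_neg, h]
      exact (Ring.CompatibleRing.funMap_neg fun i => (ts i).realize _).symm
    | add =>
      obtain ⟨q, hq, h⟩ := ih 0
      obtain ⟨r, hr, h'⟩ := ih 1
      refine ⟨add q r, by rw [termCode, termPoly_add, hq, hr]; rfl, fun K _ xs => ?_⟩
      let := Ring.compatibleRingOfRing K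
      rw [val_add, eval₂_add, h, h']
      exact (Ring.CompatibleRing.funMap_add fun i => (ts i).realize _).symm
    | mul =>
      obtain ⟨q, hq, h⟩ := ih 0
      obtain ⟨r, hr, h'⟩ := ih 1
      refine ⟨mul q r, by rw [termCode, termPoly_mul, hq, hr]; rfl, fun K _ xs => ?_⟩
      let := Ring.compatibleRingOfRing K
      rw [val_mul, eval₂_mul, h, h']
      exact (Ring.CompatibleRing.funMap_mul fun i => (ts i).realize _).symm

lemma exists_termCode_of_termPoly {k : ℕ} {q : PolyCode₂} (h : termPoly k = some q) :
    ∃ t : Language.ring.Term (Empty ⊕ Fin 2), termCode t = k := by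
  induction k using Nat.strong_induction_on generalizing q with
  | _ k ih =>
    obtain ⟨a, b, rfl⟩ : ∃ a b, k = Nat.pair a b := ⟨_, _, (Nat.pair_unpair k).symm⟩
    match a with
    | 0 =>
      rw [termPoly_eq, termStep] at h
      simp only [Nat.unpair_pair, if_true] at h
      split_ifs at h with h1 h2
      · exact ⟨.var (.inr 0), by simp [termCode, h1]⟩
      · exact ⟨.var (.inr 1), by simp [termCode, h2]⟩
    | 1 =>
      rw [termPoly_eq, termStep] at h
      simp only [Nat.unpair_pair, if_true, one_ne_zero, if_false] at h
      split_ifs at h with h1 h2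
      · exact ⟨.func ringFunc.zero Fin.elim0, by simp [termCode, h1]⟩
      · exact ⟨.func ringFunc.one Fin.elim0, by simp [termCode, h2]⟩
    | 2 =>
      rw [termPoly_neg, Option.map_eq_some_iff] at h
      obtain ⟨r, hr, -⟩ := h
      obtain ⟨t, rfl⟩ := ih b (lt_pair two_pos b) hr
      exact ⟨.func ringFunc.neg ![t], by simp [termCode]⟩
    | 3 =>
      obtain ⟨b, c, rfl⟩ : ∃ a c, b = Nat.pair a c := ⟨_, _, (Nat.pair_unpair b).symm⟩
      rw [termPoly_add, Option.bind_eq_some_iff] at h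
      obtain ⟨r, hr, h⟩ := h
      rw [Option.map_eq_some_iff] at h
      obtain ⟨r', hr', -⟩ := h
      obtain ⟨t, rfl⟩ := ih b (pair_args_lt three_pos b c).1 hr
      obtain ⟨t', rfl⟩ := ih c (pair_args_lt three_pos _ c).2 hr'
      exact ⟨.func ringFunc.add ![t, t'], by simp [termCode]⟩
    | 4 =>
      obtain ⟨b, c, rfl⟩ : ∃ a c, b = Nat.pair a c := ⟨_, _, (Nat.pair_unpair b).symm⟩
      rw [termPoly_mul, Option.bind_eq_some_iff] at h
      obtain ⟨r, hr, h⟩ := h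
      rw [Option.map_eq_some_iff] at h
      obtain ⟨r', hr', -⟩ := h
      obtain ⟨t, rfl⟩ := ih b (pair_args_lt four_pos b c).1 hr
      obtain ⟨t', rfl⟩ := ih c (pair_args_lt four_pos _ c).2 hr'
      exact ⟨.func ringFunc.mul ![t, t'], by simp [termCode]⟩
    | a + 5 =>
      rw [termPoly_eq, termStep] at h
      simp at h

section

variable {K : Type u} [Field K] {a y : K}

lemma holds_append (Φ Ψ : DNFCode) : (∃ c ∈ Φ ++ Ψ, (clauseVal c).Holds a y) ↔
    (∃ c ∈ Φ, (clauseVal c).Holds a y) ∨ ∃ c ∈ Ψ, (clauseVal c).Holds a y := by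
  simp only [List.mem_append, or_and_right, exists_or]

lemma holds_dnfAnd (Φ Ψ : DNFCode) : (∃ c ∈ dnfAnd Φ Ψ, (clauseVal c).Holds a y) ↔
    (∃ c ∈ Φ, (clauseVal c).Holds a y) ∧ ∃ c ∈ Ψ, (clauseVal c).Holds a y := by
  have key (c d : List PolyCode₂ × PolyCode₂) :
      (clauseVal (c.1 ++ d.1, mul c.2 d.2)).Holds a y ↔
        (clauseVal c).Holds a y ∧ (clauseVal d).Holds a y := by
    simp only [Clause.Holds, clauseVal, List.map_append, List.mem_append, or_imp, forall_and,
      val_mul, eval₂_mul, mul_ne_zero_iff]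
    tauto
  simp only [dnfAnd, List.mem_flatMap, List.mem_map]
  constructor
  · rintro ⟨_, ⟨c, hc, d, hd, rfl⟩, h⟩
    exact ⟨⟨c, hc, ((key c d).1 h).1⟩, d, hd, ((key c d).1 h).2⟩
  · rintro ⟨⟨c, hc, h⟩, d, hd, h'⟩
    exact ⟨_, ⟨c, hc, d, hd, rfl⟩, (key c d).2 ⟨h, h'⟩⟩

end

lemma formulaDNF_formulaCode {ψ : Language.ring.BoundedFormula Empty 2} (hψ : ψ.IsQF) :
    ∃ Φ, formulaDNF (formulaCode ψ) = some Φ ∧ ∀ (K : Type u) [Field K] (xs : Fin 2 → K),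
      letI := Ring.compatibleRingOfRing K
      ((∃ c ∈ Φ.1, (clauseVal c).Holds (xs 0) (xs 1)) ↔ ψ.Realize default xs) ∧
        ((∃ c ∈ Φ.2, (clauseVal c).Holds (xs 0) (xs 1)) ↔ ¬ψ.Realize default xs) := by
  induction hψ with
  | falsum =>
    refine ⟨_, formulaDNF_falsum, fun K _ xs => ?_⟩
    simp [Clause.Holds, clauseVal, Language.BoundedFormula.Realize]
  | of_isAtomic h =>
    cases h with
    | equal t s =>
      obtain ⟨q, hq, h⟩ := termPoly_termCode.{u} t
      obtain ⟨r, hr, h'⟩ := termPoly_termCode.{u} s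
      refine ⟨_, by
        rw [Language.Term.bdEqual, formulaCode, formulaDNF_equal, hq, hr]; rfl, fun K _ xs => ?_⟩
      let := Ring.compatibleRingOfRing K
      rw [Language.BoundedFormula.realize_bdEqual, ← h, ← h']
      simp [Clause.Holds, clauseVal, ← sub_eq_add_neg, sub_eq_zero]
    | rel R _ => exact Empty.elim R
  | imp _ _ ih₁ ih₂ =>
    obtain ⟨Φ, hΦ, h⟩ := ih₁
    obtain ⟨Ψ, hΨ, h'⟩ := ih₂
    refine ⟨_, by rw [formulaCode, formulaDNF_imp, hΦ, hΨ]; rfl, fun K _ xs => ?_⟩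
    let := Ring.compatibleRingOfRing K
    rw [holds_append, holds_dnfAnd, (h K xs).1, (h K xs).2, (h' K xs).1, (h' K xs).2,
      Language.BoundedFormula.realize_imp]
    tauto

lemma exists_formulaCode_of_formulaDNF {k : ℕ} {Φ : DNFCode × DNFCode}
    (h : formulaDNF k = some Φ) :
    ∃ ψ : Language.ring.BoundedFormula Empty 2, ψ.IsQF ∧ formulaCode ψ = k := by
  induction k using Nat.strong_induction_on generalizing Φ with
  | _ k ih =>
    obtain ⟨a, b, rfl⟩ : ∃ a b, k = Nat.pair a b := ⟨_, _, (Nat.pair_unpair k).symm⟩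
    match a with
    | 0 =>
      rw [formulaDNF_eq, formulaStep] at h
      simp only [Nat.unpair_pair, if_true] at h
      split_ifs at h with h1
      exact ⟨_, .falsum, by simp [formulaCode, h1]⟩
    | 1 =>
      obtain ⟨b, c, rfl⟩ : ∃ a c, b = Nat.pair a c := ⟨_, _, (Nat.pair_unpair b).symm⟩
      rw [formulaDNF_equal, Option.bind_eq_some_iff] at h
      obtain ⟨r, hr, h⟩ := h
      rw [Option.map_eq_some_iff] at h
      obtain ⟨r', hr', -⟩ := h
      obtain ⟨t, rfl⟩ := exists_termCode_of_termPoly hr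
      obtain ⟨t', rfl⟩ := exists_termCode_of_termPoly hr'
      exact ⟨_, .of_isAtomic (.equal t t'), by simp [formulaCode, Language.Term.bdEqual]⟩
    | 2 =>
      obtain ⟨b, c, rfl⟩ : ∃ a c, b = Nat.pair a c := ⟨_, _, (Nat.pair_unpair b).symm⟩
      rw [formulaDNF_imp, Option.bind_eq_some_iff] at h
      obtain ⟨r, hr, h⟩ := h
      rw [Option.map_eq_some_iff] at h
      obtain ⟨r', hr', -⟩ := h
      obtain ⟨ψ, h1, rfl⟩ := ih b (pair_args_lt two_pos b c).1 hr
      obtain ⟨ψ', h1', rfl⟩ := ih c (pair_args_lt two_pos _ c).2 hr'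
      exact ⟨_, h1.imp h1', by simp [formulaCode]⟩
    | a + 3 =>
      rw [formulaDNF_eq, formulaStep] at h
      simp at h

lemma formulaCode_ex_all (ψ : Language.ring.BoundedFormula Empty 2) :
    formulaCode ψ.ex.all = forallExistsCode (formulaCode ψ) := rfl

lemma matrixCode_forallExistsCode (m : ℕ) : matrixCode (forallExistsCode m) = m := by
  simp [matrixCode, forallExistsCode]

/-- The computed normal form of a sentence `∀ x ∃ y, ψ(x, y)` is correct. -/
lemma IsForallExistsForm.exists_sentenceDNF {φ : Language.ring.Sentence}
    (h : IsForallExistsForm φ) :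
    ∃ Φ, sentenceDNF (formulaCode φ) = some Φ ∧ ∀ (K : Type u) [Field K],
      Holds K φ ↔ ∀ a : K, Solvable (Φ.map clauseVal) a := by
  obtain ⟨ψ, hψ, rfl⟩ := h
  obtain ⟨Φ, h1, h2⟩ := formulaDNF_formulaCode.{u} hψ
  refine ⟨Φ.1, ?_, fun K _ => ?_⟩
  · rw [sentenceDNF, formulaCode_ex_all, matrixCode_forallExistsCode,
      if_pos rfl, h1]
    rfl
  · let := Ring.compatibleRingOfRing K
    have key (a : K) : Solvable (Φ.1.map clauseVal) a ↔
        ∃ y, ∃ c ∈ Φ.1, (clauseVal c).Holds a y := by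
      simp only [Solvable, List.mem_map, exists_exists_and_eq_and]
      exact ⟨fun ⟨c, hc, y, h⟩ => ⟨y, c, hc, h⟩, fun ⟨y, c, hc, h⟩ => ⟨c, hc, y, h⟩⟩
    have hrw : Holds K ψ.ex.all ↔ ∀ a : K, ∃ y : K,
        ψ.Realize default (Fin.snoc (Fin.snoc default a) y) := by
      simp only [Holds, Language.Sentence.Realize, Language.Formula.Realize,
        Language.BoundedFormula.realize_all, Language.BoundedFormula.realize_ex]
    rw [hrw]
    refine forall_congr' fun a => ?_
    rw [key]
    refine exists_congr fun y => ?_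
    rw [← (h2 K _).1]
    rfl

lemma exists_of_sentenceDNF {k : ℕ} {Φ : DNFCode} (h : sentenceDNF k = some Φ) :
    ∃ φ, IsForallExistsForm φ ∧ formulaCode φ = k := by
  rw [sentenceDNF] at h
  split_ifs at h with h1
  rw [Option.map_eq_some_iff] at h
  obtain ⟨Ψ, h2, -⟩ := h
  obtain ⟨ψ, hψ, h3⟩ := exists_formulaCode_of_formulaDNF h2
  exact ⟨_, ⟨ψ, hψ, rfl⟩, by rw [formulaCode_ex_all, h3, h1]⟩

/-! ### Hilbertian and infinite fields -/

lemma holds_iff_of_iff {φ χ : Language.ring.Sentence}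
    (h : Language.Theory.Iff (∅ : Language.ring.Theory) φ χ) (K : Type u) [Field K] :
    Holds K φ ↔ Holds K χ := by
  let := Ring.compatibleRingOfRing K
  exact Language.Theory.Iff.models_sentence_iff h (M := K)

/-- An infinite field satisfies every `∀¹∃¹` sentence that holds in its Hilbertian extension by
infinitely many transcendentals. -/
lemma IsForallExists.holds_of_holds_ratFuncNat {φ : Language.ring.Sentence} (h : IsForallExists φ)
    {K : Type u} [Field K] [Infinite K] (hφ : Holds (RatFuncNat K) φ) : Holds K φ := by
  obtain ⟨χ, hχ, h⟩ := h
  rw [holds_iff_of_iff h] at hφ ⊢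
  obtain ⟨Φ, -, hΦ⟩ := hχ.exists_sentenceDNF
  rw [hΦ] at hφ ⊢
  exact fun a => (hφ _).ratFuncNat.elim (·.solvable) id

theorem forallExistsTheory_isHilbertian :
    forallExistsTheory.{u} (fun K _ => IsHilbertian K) =
      forallExistsTheory.{u} (fun K _ => Infinite K) := by
  ext φ
  refine and_congr_right fun h => ⟨fun H K _ hK => ?_, fun H K _ hK => H K hK.infinite⟩
  exact h.holds_of_holds_ratFuncNat (H _ (isHilbertian_ratFuncNat K))

/-- Truth in all infinite fields, in terms of the computed normal form. -/
lemma mem_forallExistsTheory_iff {k : ℕ} :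
    (∃ φ, IsForallExistsForm φ ∧ formulaCode φ = k ∧
      φ ∈ forallExistsTheory.{u} (fun K _ => Infinite K)) ↔
    ∃ Φ, sentenceDNF k = some Φ ∧ TrueInInfinite.{u} (Φ.map clauseVal) := by
  constructor
  · rintro ⟨φ, h, rfl, -, h1⟩
    obtain ⟨Φ, h2, h3⟩ := h.exists_sentenceDNF.{u}
    exact ⟨Φ, h2, fun K _ hK => (h3 K).1 (h1 K hK)⟩
  · rintro ⟨Φ, h, h1⟩
    obtain ⟨φ, h2, rfl⟩ := exists_of_sentenceDNF h
    obtain ⟨Φ', h3, h4⟩ := h2.exists_sentenceDNF.{u}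
    obtain rfl : Φ = Φ' := by rwa [h, Option.some_inj] at h3
    exact ⟨φ, h2, rfl, ⟨φ, h2, .refl φ⟩, fun K _ hK => (h4 K).2 fun a => h1 K a⟩

/-! ### Certificates of truth -/

lemma val_int_surjective : Function.Surjective (val : ℕ × ℕ → ℤ) := by
  intro z
  refine ⟨(z.toNat, (-z).toNat), ?_⟩
  rw [val_int]
  exact Int.toNat_sub_toNat_neg z

lemma val_polyCode_surjective : Function.Surjective (val : PolyCode → ℤ[X]) :=
  exists_val_eq val_int_surjective

lemma val_eq_zero_iff {l : PolyCode} : val l = 0 ↔ ∀ c ∈ l, c.1 = c.2 := by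
  have h := forall_coeff_val (l := l) (p := fun z => z = 0) rfl
  rw [Polynomial.ext_iff]
  simp only [coeff_zero, h, val_int, sub_eq_zero, Nat.cast_inj]

section Homog

variable {R S : Type} [Primcodable R] [CommRing S] [CompRing R S]

/-- The numerator of the value of a polynomial at the fraction `u / v`, up to a power of `v`. -/
def homog (q : List R) (u v : R) : R :=
  (q.foldr (fun c x => (add (mul c x.2) (mul u x.1), mul v x.2)) (zero, one)).1

lemma homog_eq_zero_iff {K : Type*} [Field K] (φ : S →+* K) (q : List R) {u v : R} {y : K}
    (hv : φ (val v) ≠ 0) (hu : φ (val u) = y * φ (val v)) :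
    φ (val (homog q u v)) = 0 ↔ (val q).eval₂ φ y = 0 := by
  have key (q : List R) :
      let x := q.foldr (fun c x => (add (mul c x.2) (mul u x.1), mul v x.2)) (zero, one)
      φ (val v) * φ (val x.1) = φ (val x.2) * (val q).eval₂ φ y ∧ φ (val x.2) ≠ 0 := by
    induction q with
    | nil => simp [val_nil]
    | cons c q ih =>
      simp only [List.foldr_cons, val_add, val_mul, map_add, map_mul, val_cons, eval₂_add,
        eval₂_C, eval₂_mul, eval₂_X] at ih ⊢
      refine ⟨?_, mul_ne_zero hv ih.2⟩
      rw [mul_add, ← mul_assoc _ (φ (val u)), mul_comm _ (φ (val u)), mul_assoc, ih.1, hu]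
      ring
  obtain ⟨h1, h2⟩ := key q
  have h3 : φ (val (homog q u v)) = 0 ↔ φ (val v) * φ (val (homog q u v)) = 0 := by simp [hv]
  rw [h3, homog, h1, mul_eq_zero]
  simp [h2]

lemma primrec_homog : Primrec fun x : List R × R × R => homog x.1 x.2.1 x.2.2 := by
  refine Primrec.fst.comp (Primrec.list_foldr (f := fun x : List R × R × R => x.1)
    (g := fun _ => (zero, one))
    (h := fun x y => (add (mul y.1 y.2.2) (mul x.2.1 y.2.1), mul x.2.2 y.2.2)) .fst (.const _) ?_)
  refine Primrec.pair (primrec_add.comp (primrec_mul.comp ?_ ?_) (primrec_mul.comp ?_ ?_))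
    (primrec_mul.comp ?_ ?_)
  · exact Primrec.fst.comp .snd
  · exact Primrec.snd.comp (Primrec.snd.comp .snd)
  · exact Primrec.fst.comp (Primrec.snd.comp .fst)
  · exact Primrec.fst.comp (Primrec.snd.comp .snd)
  · exact Primrec.snd.comp (Primrec.snd.comp .fst)
  · exact Primrec.snd.comp (Primrec.snd.comp .snd)

/-- The function `branches` on codes. -/
def codeBranches (l : List (List R × R)) : List (R × List R) :=
  l.foldr (fun i b => b.flatMap fun s =>
    (s.1, i.2 :: s.2) :: i.1.map fun z => (mul z s.1, s.2)) [(one, [])]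

lemma map_codeBranches (l : List (List R × R)) :
    (codeBranches l).map (fun s => (val s.1, s.2.map val)) =
      branches (l.map fun i => (i.1.map val, val i.2)) := by
  induction l with
  | nil => simp [codeBranches, branches]
  | cons i l ih =>
    have h : codeBranches (i :: l) = (codeBranches l).flatMap fun s =>
      (s.1, i.2 :: s.2) :: i.1.map fun z => (mul z s.1, s.2) := rfl
    rw [h, List.map_cons, branches, ← ih, List.map_flatMap, List.flatMap_map]
    congr 1
    funext s
    simp

lemma primrec_codeBranches : Primrec (codeBranches (R := R)) := by
  refine Primrec.list_foldr (f := fun l : List (List R × R) => l)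
    (g := fun _ => [(one, [])])
    (h := fun _ y => y.2.flatMap fun s =>
      (s.1, y.1.2 :: s.2) :: y.1.1.map fun z => (mul z s.1, s.2)) .id (.const _) ?_
  refine Primrec.list_flatMap (Primrec.snd.comp .snd) ?_
  have hi : Primrec fun x : (List (List R × R) × (List R × R) × List (R × List R)) ×
      (R × List R) => x.1.2.1 := Primrec.fst.comp (Primrec.snd.comp .fst)
  refine Primrec.list_cons.comp (Primrec.pair (Primrec.fst.comp .snd)
    (Primrec.list_cons.comp (Primrec.snd.comp hi) (Primrec.snd.comp .snd)))
    (Primrec.list_map (Primrec.fst.comp hi) ?_)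
  exact Primrec.pair (primrec_mul.comp .snd (Primrec.fst.comp (Primrec.snd.comp .fst)))
    (Primrec.snd.comp (Primrec.snd.comp .fst))

end Homog

/-- The conditions on a point `a` for a clause to hold generically or at one of the given fractions
in `a`. Such a condition `(l, g)` says that the polynomials in `l` vanish at `a`, and `g` does
not. -/
noncomputable def insts (Φ : DNFCode) (L : List (PolyCode × PolyCode)) :
    List (List PolyCode × PolyCode) :=
  Φ.flatMap fun c => c.2.map (fun g => (c.1.flatten, g)) ++
    L.map fun f => (c.1.map (fun q => homog q f.1 f.2), mul f.2 (homog c.2 f.1 f.2))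

/-- Certificates for the truth of a sentence in all infinite fields. The certificate consists of a
list `L` of fractions and of data which show that every point of the spectrum of `ℤ[X]` satisfies
one of the conditions in `insts Φ L`: exponents of powers, and coefficients of linear
combinations. -/
def TrueCert (Φ : DNFCode) (t : List (PolyCode × PolyCode) × List (ℕ × List PolyCode)) : Prop :=
  ∀ s ∈ codeBranches (insts Φ t.1), ∃ e ∈ t.2,
    ∀ c ∈ add (pow s.1 e.1) (neg (comb e.2 s.2)), c.1 = c.2

lemma map_eq_zero_iff_forall_mem {K : Type*} [Field K] (φ : ℤ[X] →+* K) (q : PolyCode₂) :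
    (val q).map φ = 0 ↔ ∀ c ∈ q, φ (val c) = 0 := by
  rw [← forall_coeff_val (p := fun z => φ z = 0) (map_zero φ), Polynomial.ext_iff]
  simp

lemma holdsGen_clauseVal {K : Type*} [Field K] {a : K} {c : List PolyCode₂ × PolyCode₂} :
    (clauseVal c).HoldsGen a ↔
      ∃ g ∈ c.2, (∀ z ∈ c.1.flatten, evalAt a (val z) = 0) ∧ evalAt a (val g) ≠ 0 := by
  simp only [Clause.HoldsGen, clauseVal, List.mem_map, forall_exists_index, and_imp,
    forall_apply_eq_imp_iff₂, map_eq_zero_iff_forall_mem, ne_eq, List.mem_flatten, not_forall,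
    exists_prop]
  constructor
  · rintro ⟨h, g, hg, h'⟩
    exact ⟨g, hg, fun z q hq hz => h q hq z hz, h'⟩
  · rintro ⟨g, hg, h, h'⟩
    exact ⟨fun q hq z hz => h z q hq hz, g, hg, h'⟩

lemma holds_clauseVal {K : Type*} [Field K] {a y : K} {c : List PolyCode₂ × PolyCode₂}
    {u v : PolyCode} (hv : evalAt a (val v) ≠ 0) (hu : evalAt a (val u) = y * evalAt a (val v)) :
    (clauseVal c).Holds a y ↔ (∀ q ∈ c.1, evalAt a (val (homog q u v)) = 0) ∧
      evalAt a (val (homog c.2 u v)) ≠ 0 := by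
  simp only [Clause.Holds, clauseVal, List.mem_map, forall_exists_index, and_imp,
    forall_apply_eq_imp_iff₂, homog_eq_zero_iff (evalAt a) _ hv hu, ne_eq]

lemma solvable_of_mem_insts {K : Type*} [Field K] {a : K} {Φ : DNFCode}
    {L : List (PolyCode × PolyCode)} {i : List PolyCode × PolyCode} (hi : i ∈ insts Φ L)
    (h : (∀ z ∈ i.1, evalAt a (val z) = 0) ∧ evalAt a (val i.2) ≠ 0) :
    SolvableGen (Φ.map clauseVal) a ∨ Solvable (Φ.map clauseVal) a := by
  simp only [insts, List.mem_flatMap, List.mem_append, List.mem_map] at hi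
  obtain ⟨c, hc, ⟨g, hg, rfl⟩ | ⟨⟨u, v⟩, -, rfl⟩⟩ := hi
  · exact .inl ⟨_, List.mem_map_of_mem hc, holdsGen_clauseVal.2 ⟨g, hg, h⟩⟩
  · rw [val_mul, map_mul, mul_ne_zero_iff] at h
    refine .inr ⟨_, List.mem_map_of_mem hc, evalAt a (val u) / evalAt a (val v),
      (holds_clauseVal h.2.1 (div_mul_cancel₀ _ h.2.1).symm).2 ⟨fun q hq => ?_, h.2.2⟩⟩
    exact h.1 _ (List.mem_map_of_mem hq)

lemma exists_mem_insts {K : Type*} [Field K] {a : K} {Φ : DNFCode}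
    (hK : ∀ y : K, ∃ u v : ℤ[X], evalAt a v ≠ 0 ∧ evalAt a u = y * evalAt a v)
    (h : SolvableGen (Φ.map clauseVal) a ∨ Solvable (Φ.map clauseVal) a) :
    ∃ f, ∃ i ∈ insts Φ [f], (∀ z ∈ i.1, evalAt a (val z) = 0) ∧ evalAt a (val i.2) ≠ 0 := by
  rcases h with ⟨_, hc, h⟩ | ⟨_, hc, y, h⟩ <;> obtain ⟨c, hc', rfl⟩ := List.mem_map.1 hc
  · obtain ⟨g, hg, h⟩ := holdsGen_clauseVal.1 h
    refine ⟨([], []), (c.1.flatten, g), ?_, h⟩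
    exact List.mem_flatMap.2 ⟨c, hc', List.mem_append_left _ (List.mem_map.2 ⟨g, hg, rfl⟩)⟩
  · obtain ⟨u, v, hv, hu⟩ := hK y
    obtain ⟨u, rfl⟩ := val_polyCode_surjective u
    obtain ⟨v, rfl⟩ := val_polyCode_surjective v
    refine ⟨(u, v), (c.1.map (fun q => homog q u v), mul v (homog c.2 u v)), ?_, ?_⟩
    · exact List.mem_flatMap.2 ⟨c, hc', List.mem_append_right _ (by simp)⟩
    · rw [holds_clauseVal hv hu] at h
      rw [val_mul, map_mul]
      exact ⟨fun z hz => by obtain ⟨q, hq, rfl⟩ := List.mem_map.1 hz; exact h.1 q hq,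
        mul_ne_zero hv h.2⟩

lemma insts_subset {Φ : DNFCode} {L L' : List (PolyCode × PolyCode)} (h : L ⊆ L') :
    insts Φ L ⊆ insts Φ L' := by
  intro i hi
  simp only [insts, List.mem_flatMap, List.mem_append, List.mem_map] at hi ⊢
  obtain ⟨c, hc, hi | ⟨f, hf, rfl⟩⟩ := hi
  · exact ⟨c, hc, .inl hi⟩
  · exact ⟨c, hc, .inr ⟨f, h hf, rfl⟩⟩

/-- The equations in a certificate say that powers of polynomials are linear combinations. -/
lemma trueCert_iff {Φ : DNFCode} {t : List (PolyCode × PolyCode) × List (ℕ × List PolyCode)} :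
    TrueCert Φ t ↔ ∀ s ∈ codeBranches (insts Φ t.1), ∃ e ∈ t.2,
      val s.1 ^ e.1 = val (comb e.2 s.2) := by
  simp only [TrueCert, ← val_eq_zero_iff, val_add, val_neg, val_pow, ← sub_eq_add_neg, sub_eq_zero]

lemma TrueCert.trueInInfinite {Φ : DNFCode}
    {t : List (PolyCode × PolyCode) × List (ℕ × List PolyCode)} (h : TrueCert Φ t) :
    TrueInInfinite.{u} (Φ.map clauseVal) := by
  intro K _ _ a
  rw [trueCert_iff] at h
  obtain ⟨i, hi, h1⟩ := exists_of_forall_branches (evalAt a)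
    (l := (insts Φ t.1).map fun i => (i.1.map val, val i.2)) (fun s hs => by
      rw [← map_codeBranches] at hs
      obtain ⟨s, hs', rfl⟩ := List.mem_map.1 hs
      obtain ⟨e, -, he⟩ := h s hs'
      exact ⟨e.1, he ▸ val_comb_mem_span _ _⟩)
  obtain ⟨i, hi', rfl⟩ := List.mem_map.1 hi
  exact (solvable_of_mem_insts hi' ⟨fun z hz => h1.1 _ (List.mem_map_of_mem hz), h1.2⟩).elim
    (·.solvable) id

lemma exists_list_of_forall_exists {α β : Type*} {r : α → β → Prop} {l : List α}
    (h : ∀ x ∈ l, ∃ y, r x y) : ∃ l' : List β, ∀ x ∈ l, ∃ y ∈ l', r x y := by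
  induction l with
  | nil => exact ⟨[], by simp⟩
  | cons x l ih =>
    obtain ⟨l', hl'⟩ := ih fun x hx => h x (List.mem_cons_of_mem _ hx)
    obtain ⟨y, hy⟩ := h x List.mem_cons_self
    refine ⟨y :: l', fun z hz => ?_⟩
    rcases List.mem_cons.1 hz with rfl | hz
    · exact ⟨y, List.mem_cons_self, hy⟩
    · obtain ⟨w, hw, h⟩ := hl' z hz
      exact ⟨w, List.mem_cons_of_mem _ hw, h⟩

/-- By compactness of the spectrum of `ℤ[X]`, true sentences have certificates. -/
lemma TrueInInfinite.exists_trueCert {Φ : DNFCode}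
    (h : TrueInInfinite.{u} (Φ.map clauseVal)) : ∃ t, TrueCert Φ t := by
  obtain ⟨l, hl, hcover⟩ := exists_finite_cover
    {i : List ℤ[X] × ℤ[X] | ∃ f, i ∈ (insts Φ [f]).map fun i => (i.1.map val, val i.2)} (by
    intro P hP
    let φ : ℤ[X] →+* FractionRing (ℤ[X] ⧸ P) :=
      (algebraMap (ℤ[X] ⧸ P) (FractionRing (ℤ[X] ⧸ P))).comp (Ideal.Quotient.mk P)
    have hφ : evalAt (φ X) = φ := by ext <;> simp
    have hmem (f : ℤ[X]) : φ f = 0 ↔ f ∈ P := by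
      rw [← Ideal.Quotient.eq_zero_iff_mem]
      exact IsFractionRing.to_map_eq_zero_iff (R := ℤ[X] ⧸ P)
    obtain ⟨f, i, hi, h1, h2⟩ := exists_mem_insts (a := φ X) (Φ := Φ) (by
      intro y
      obtain ⟨u, v, hv, rfl⟩ := IsFractionRing.div_surjective (A := ℤ[X] ⧸ P) y
      obtain ⟨u, rfl⟩ := Ideal.Quotient.mk_surjective u
      obtain ⟨v, rfl⟩ := Ideal.Quotient.mk_surjective v
      rw [hφ]
      have hv0 : φ v ≠ 0 := fun h0 =>
        nonZeroDivisors.ne_zero hv (IsFractionRing.to_map_eq_zero_iff.1 h0)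
      exact ⟨u, v, hφ ▸ hv0, (div_mul_cancel₀ (φ u) hv0).symm⟩) (h.solvableGen_or_solvable _)
    rw [hφ] at h1 h2
    refine ⟨_, ⟨f, List.mem_map_of_mem hi⟩, fun z hz => ?_, fun h0 => h2 ((hmem _).2 h0)⟩
    obtain ⟨w, hw, rfl⟩ := List.mem_map.1 hz
    exact (hmem _).1 (h1 w hw))
  obtain ⟨L, hL⟩ := exists_list_of_forall_exists hl
  have hsub : ∀ i ∈ l, i ∈ (insts Φ L).map fun i => (i.1.map val, val i.2) := fun i hi => by
    obtain ⟨f, hf, h⟩ := hL i hi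
    exact List.map_subset _ (insts_subset (by simpa using hf)) h
  obtain ⟨certs, hcerts⟩ := exists_list_of_forall_exists (l := codeBranches (insts Φ L))
    (r := fun s (e : ℕ × List PolyCode) => val s.1 ^ e.1 = val (comb e.2 s.2)) (by
    intro s hs
    obtain ⟨n, hn⟩ := exists_pow_mem_span_of_cover
      (l := (insts Φ L).map fun i => (i.1.map val, val i.2))
      (fun P hP => let ⟨i, hi, h⟩ := hcover P hP; ⟨i, hsub i hi, h⟩)
      (by rw [← map_codeBranches]; exact List.mem_map_of_mem hs)
    obtain ⟨cs, hcs⟩ := exists_val_comb val_polyCode_surjective _ hn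
    exact ⟨(n, cs), hcs.symm⟩)
  exact ⟨(L, certs), trueCert_iff.2 hcerts⟩

/-! ### Computations at an algebraic or transcendental point -/

/-- The monic integer polynomial with the given list of lower coefficients. -/
noncomputable def modulus (μ : PolyCode) : ℤ[X] := X ^ μ.length + val μ

lemma degree_val_lt (l : PolyCode) : (val l).degree < l.length :=
  (degree_lt_iff_coeff_zero _ _).2 fun _ h => coeff_val_eq_zero h

lemma modulus_monic (μ : PolyCode) : (modulus μ).Monic :=
  monic_X_pow_add (degree_val_lt μ)

lemma natDegree_modulus (μ : PolyCode) : (modulus μ).natDegree = μ.length :=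
  natDegree_eq_of_degree_eq_some
    ((degree_add_eq_left_of_degree_lt ((degree_val_lt μ).trans_eq (degree_X_pow _).symm)).trans
      (degree_X_pow _))

/-- The remainder of `c + X * r` in the division by `modulus μ`, for `r` of smaller degree. -/
def remStep (μ : PolyCode) (c : ℕ × ℕ) (r : PolyCode) : PolyCode :=
  (List.range μ.length).map fun i =>
    add ((c :: r).getD i zero) (neg (mul ((c :: r).getD μ.length zero) (μ.getD i zero)))

/-- The remainder in the division by `modulus μ`. The empty list `μ` stands for division
by `0`. -/
def remCode (μ q : PolyCode) : PolyCode := if μ = [] then q else q.foldr (remStep μ) []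

lemma length_foldr_remStep (μ q : PolyCode) : (q.foldr (remStep μ) []).length ≤ μ.length := by
  cases q <;> simp [remStep]

lemma val_remStep (μ : PolyCode) (c : ℕ × ℕ) (r : PolyCode) (hr : r.length ≤ μ.length) :
    modulus μ ∣ val (c :: r) - val (remStep μ c r) := by
  refine ⟨C (val ((c :: r).getD μ.length zero)), ?_⟩
  ext i
  rw [coeff_sub, coeff_mul_C, modulus, coeff_add, coeff_X_pow, coeff_val, coeff_val, coeff_val,
    remStep, getD_map_range]
  rcases lt_trichotomy i μ.length with h | rfl | h
  · rw [if_pos h, if_neg h.ne, val_add, val_neg, val_mul]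
    ring
  · rw [if_neg (lt_irrefl _), if_pos rfl, List.getD_eq_default μ _ le_rfl, val_zero]
    ring
  · rw [if_neg h.not_gt, if_neg h.ne', List.getD_eq_default μ _ h.le,
      List.getD_eq_default (c :: r) _ (by simp; omega), val_zero]
    ring

lemma modulus_dvd_sub_foldr (μ q : PolyCode) :
    modulus μ ∣ val q - val (q.foldr (remStep μ) []) := by
  induction q with
  | nil => simp
  | cons c q ih =>
    have h := val_remStep μ c _ (length_foldr_remStep μ q)
    rw [List.foldr_cons]
    convert dvd_add (Dvd.dvd.mul_left ih X) h using 1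
    rw [val_cons, val_cons]
    ring

/-- The value of a polynomial vanishes at the point given by `p` and `μ`: this is a root of
`modulus μ`, or a transcendental element if `μ` is empty, in a field of characteristic `p`. -/
def Vanish (p : ℕ) (μ q : PolyCode) : Prop := ∀ c ∈ remCode μ q, c.1 % p = c.2 % p

section Vanish

variable {A : Type*} [CommRing A] {p : ℕ} [CharP A p]

lemma map_val_eq_zero_iff (q : PolyCode) :
    (val q).map (Int.castRingHom A) = 0 ↔ ∀ c ∈ q, c.1 % p = c.2 % p := by
  have h := forall_coeff_val (l := q) (p := fun z => (z : A) = 0) Int.cast_zero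
  rw [Polynomial.ext_iff]
  simp only [coeff_map, eq_intCast, coeff_zero, h]
  refine forall₂_congr fun c _ => ?_
  rw [val_int, CharP.intCast_eq_zero_iff A p, ← neg_sub, dvd_neg, ← Nat.modEq_iff_dvd]
  rfl

variable (A) in
lemma vanish_nil_iff {q : PolyCode} :
    Vanish p [] q ↔ (val q).map (Int.castRingHom A) = 0 := by
  rw [map_val_eq_zero_iff (p := p)]
  rfl

variable (A) in
lemma vanish_iff_dvd [Nontrivial A] {μ q : PolyCode} (hμ : μ ≠ []) : Vanish p μ q ↔
    (modulus μ).map (Int.castRingHom A) ∣ (val q).map (Int.castRingHom A) := by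
  rw [Vanish, remCode, if_neg hμ, ← map_val_eq_zero_iff (A := A)]
  set r := q.foldr (remStep μ) [] with hr
  have h1 := Polynomial.map_dvd (Int.castRingHom A) (modulus_dvd_sub_foldr μ q)
  rw [Polynomial.map_sub] at h1
  rw [dvd_iff_dvd_of_dvd_sub h1]
  constructor
  · intro h
    rw [h]
    exact dvd_zero _
  · intro h
    by_contra h0
    have hm := (modulus_monic μ).map (Int.castRingHom A)
    refine hm.not_dvd_of_degree_lt h0 ?_ h
    rw [degree_eq_natDegree hm.ne_zero, (modulus_monic μ).natDegree_map, natDegree_modulus]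
    refine degree_map_le.trans_lt ((degree_val_lt _).trans_le ?_)
    exact_mod_cast length_foldr_remStep μ q

end Vanish

/-- Codes for the integers of absolute value at most `H`. -/
def digits (H : ℕ) : List (ℕ × ℕ) := (List.range (H + 1)).flatMap fun i => [(i, 0), (0, i)]

/-- Codes for the polynomials of degree less than `m` with coefficients of absolute value at
most `H`. -/
def box (H m : ℕ) : List PolyCode :=
  Nat.rec [ [] ] (fun _ l => (digits H).flatMap fun c => l.map (List.cons c)) m

lemma exists_mem_digits {H : ℕ} {z : ℤ} (hz : z.natAbs ≤ H) : ∃ c ∈ digits H, val c = z := by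
  have hmem : ∀ c ∈ [(z.natAbs, 0), (0, z.natAbs)], c ∈ digits H := fun c hc =>
    List.mem_flatMap.2 ⟨_, List.mem_range.2 (Nat.lt_succ_of_le hz), hc⟩
  rcases le_total 0 z with h | h
  · exact ⟨(z.natAbs, 0), hmem _ (by simp), by simp [val_int, abs_of_nonneg h]⟩
  · exact ⟨(0, z.natAbs), hmem _ (by simp), by simp [val_int, abs_of_nonpos h]⟩

lemma exists_mem_box {H m : ℕ} {f : ℤ[X]} (hf : f.degree < m)
    (hc : ∀ i, (f.coeff i).natAbs ≤ H) : ∃ u ∈ box H m, val u = f := by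
  induction m generalizing f with
  | zero =>
    have : f = 0 := by
      rw [← degree_eq_bot]
      exact Nat.WithBot.lt_zero_iff.1 hf
    exact ⟨[], List.mem_singleton_self _, this.symm⟩
  | succ m ih =>
    obtain ⟨u, hu, h1⟩ := ih (f := f.divX)
      ((degree_lt_iff_coeff_zero _ _).2 fun i hi => by
        rw [coeff_divX]
        exact coeff_eq_zero_of_degree_lt (hf.trans_le (by exact_mod_cast Nat.succ_le_succ hi)))
      (fun i => by rw [coeff_divX]; exact hc _)
    obtain ⟨c, hcd, h2⟩ := exists_mem_digits (hc 0)
    refine ⟨c :: u, List.mem_flatMap.2 ⟨c, hcd, List.mem_map_of_mem hu⟩, ?_⟩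
    rw [val_cons, h1, h2, add_comm]
    exact X_mul_divX_add f

lemma InBox.exists_mem_box {s : ℕ} {f : ℤ[X]} (hf : InBox s f) :
    ∃ u ∈ box (coeffBound s) (2 * s + 1), val u = f :=
  HilbertianDecidability.exists_mem_box
    (degree_le_natDegree.trans_lt (by exact_mod_cast Nat.lt_succ_of_le hf.1)) hf.2

/-- A decidable condition which ensures that `p` and `μ` define a point of a field, of complexity
bounded by `s`. The last part says that there are no zero divisors among the polynomials in the box;
it forces `modulus μ` to be irreducible, because the factors of this polynomial are in the box. -/
def PointCheck (s p : ℕ) (μ : PolyCode) : Prop :=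
  (p = 0 ∨ p.Prime) ∧ p ≤ s ∧ μ.length ≤ s ∧ (∀ c ∈ μ, c.1 ≤ s ∧ c.2 ≤ s) ∧
    ∀ u ∈ box (coeffBound s) μ.length, ∀ w ∈ box (coeffBound s) μ.length,
      Vanish p μ (mul u w) → Vanish p μ u ∨ Vanish p μ w

/-- Codes with coefficients and numbers of coefficients at most `s`. -/
def SmallCode (s : ℕ) (l : PolyCode) : Prop := l.length ≤ s ∧ ∀ c ∈ l, c.1 ≤ s ∧ c.2 ≤ s

lemma SmallCode.natAbs_coeff_le {s : ℕ} {l : PolyCode} (h : ∀ c ∈ l, c.1 ≤ s ∧ c.2 ≤ s) (i : ℕ) :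
    ((val l).coeff i).natAbs ≤ s := by
  refine (forall_coeff_val (p := fun z : ℤ => z.natAbs ≤ s) (by simp)).2 (fun c hc => ?_) i
  have := h c hc
  rw [val_int]
  omega

lemma SmallCode.smallPoly {s : ℕ} {l : PolyCode} (h : SmallCode s l) : SmallPoly s (val l) :=
  ⟨natDegree_le_of_degree_le ((degree_val_lt l).le.trans (by exact_mod_cast h.1)),
    SmallCode.natAbs_coeff_le h.2⟩

lemma PointCheck.smallPoly_modulus {s p : ℕ} {μ : PolyCode} (h : PointCheck s p μ) (hμ : μ ≠ []) :
    SmallPoly s (modulus μ) := by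
  have hs : 1 ≤ s := (List.length_pos_iff.2 hμ).trans_le h.2.2.1
  refine ⟨(natDegree_modulus μ).trans_le h.2.2.1, fun i => ?_⟩
  rw [modulus, coeff_add, coeff_X_pow]
  split_ifs with hi
  · rw [coeff_val_eq_zero hi.ge]
    simpa using hs
  · rw [zero_add]
    exact SmallCode.natAbs_coeff_le h.2.2.2.1 i

lemma PointCheck.irreducible_modulus {s p : ℕ} {μ : PolyCode} (h : PointCheck s p μ) (hμ : μ ≠ [])
    (A : Type*) [CommRing A] [IsDomain A] [CharP A p]
    (hlift : ∀ f : A[X], f.Monic → f ∣ (modulus μ).map (Int.castRingHom A) →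
      ∃ F : ℤ[X], F.map (Int.castRingHom A) = f ∧ F.natDegree ≤ f.natDegree ∧
        ∀ i, (F.coeff i).natAbs ≤ coeffBound s) :
    Irreducible ((modulus μ).map (Int.castRingHom A)) := by
  have hm := (modulus_monic μ).map (Int.castRingHom A)
  have hd : ((modulus μ).map (Int.castRingHom A)).natDegree = μ.length := by
    rw [(modulus_monic μ).natDegree_map, natDegree_modulus]
  have hμ0 : 0 < μ.length := List.length_pos_iff.2 hμ
  rw [hm.irreducible_iff_natDegree']
  refine ⟨fun h1 => ?_, fun f g hf hg hfg hmem => ?_⟩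
  · rw [h1, natDegree_one] at hd
    omega
  · rw [Finset.mem_Ioc, hd] at hmem
    have hdeg : f.natDegree + g.natDegree = μ.length := by
      rw [← hd, ← hfg, hf.natDegree_mul hg]
    have key (f : A[X]) (hf : f.Monic) (hfd : f ∣ (modulus μ).map (Int.castRingHom A))
        (hlt : f.natDegree < μ.length) : ∃ u ∈ box (coeffBound s) μ.length,
          (val u).map (Int.castRingHom A) = f ∧ ¬Vanish p μ u := by
      obtain ⟨F, h1, h2, h3⟩ := hlift f hf hfd
      obtain ⟨u, hu, rfl⟩ := exists_mem_box (m := μ.length)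
        (degree_le_natDegree.trans_lt (by exact_mod_cast h2.trans_lt hlt)) h3
      refine ⟨u, hu, h1, fun hv => ?_⟩
      rw [vanish_iff_dvd A hμ, h1] at hv
      have := natDegree_le_of_dvd hv hf.ne_zero
      omega
    obtain ⟨u, hu, h1, h2⟩ := key f hf (Dvd.intro _ hfg) (by omega)
    obtain ⟨w, hw, h3, h4⟩ := key g hg (Dvd.intro_left _ hfg) (by omega)
    refine (h.2.2.2.2 u hu w hw ?_).elim h2 h4
    rw [vanish_iff_dvd A hμ, val_mul, Polynomial.map_mul, h1, h3, hfg]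

/-- A point at which vanishing is decided by `Vanish p μ`, and at which the roots of polynomials of
complexity at most `s` are fractions from the box. -/
def GoodPoint (s p : ℕ) (μ : PolyCode) : Prop :=
  ∃ (k : Type) (_ : Field k) (a : k), (∀ q, Vanish p μ q ↔ evalAt a (val q) = 0) ∧
    ∀ (q : ℤ[X][X]) (y : k), SmallPoly₂ s q → q.map (evalAt a) ≠ 0 → q.eval₂ (evalAt a) y = 0 →
      IsBoxFraction s a y

lemma goodPoint_zmod_nil {s p : ℕ} (hp : p.Prime) (hs : p ≤ s) : GoodPoint s p [] := by
  have := Fact.mk hp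
  refine ⟨FractionRing (ZMod p)[X], inferInstance, algebraMap _ _ X, fun q => ?_,
    fun q y h1 h2 h3 => isBoxFraction_of_root_zmod hs h1 h2 h3⟩
  have he : evalAt (algebraMap (ZMod p)[X] (FractionRing (ZMod p)[X]) X) =
      (algebraMap _ _).comp (mapRingHom (Int.castRingHom (ZMod p))) := by
    ext <;> simp
  rw [vanish_nil_iff (ZMod p), he, RingHom.comp_apply, IsFractionRing.to_map_eq_zero_iff]
  rfl

lemma goodPoint_rat_nil (s : ℕ) : GoodPoint s 0 [] := by
  refine ⟨FractionRing ℤ[X], inferInstance, algebraMap _ _ X, fun q => ?_,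
    fun q y h1 h2 h3 => isBoxFraction_of_root_rat h1 h2 h3⟩
  have he : evalAt (algebraMap ℤ[X] (FractionRing ℤ[X]) X) = algebraMap _ _ := by
    ext <;> simp
  rw [vanish_nil_iff ℤ, he, IsFractionRing.to_map_eq_zero_iff, Int.castRingHom_int, map_id]

lemma PointCheck.goodPoint_zmod {s p : ℕ} {μ : PolyCode} (h : PointCheck s p μ) (hμ : μ ≠ [])
    (hp : p.Prime) : GoodPoint s p μ := by
  have := Fact.mk hp
  have hps : p ≤ coeffBound s := h.2.1.trans (self_le_coeffBound s)
  set M := (modulus μ).map (Int.castRingHom (ZMod p)) with hM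
  have hMm : M.Monic := (modulus_monic μ).map _
  have hirr : Irreducible M := h.irreducible_modulus hμ (ZMod p) fun f _ _ =>
    let ⟨F, h1, h2, h3⟩ := exists_lift_zmod f
    ⟨F, h1, h2, fun i => (h3 i).trans hps⟩
  have := Fact.mk hirr
  have he (q : ℤ[X]) : evalAt (AdjoinRoot.root M) q =
      AdjoinRoot.mk M (q.map (Int.castRingHom (ZMod p))) := by
    have : evalAt (AdjoinRoot.root M) =
        (AdjoinRoot.mk M).comp (mapRingHom (Int.castRingHom (ZMod p))) := by
      ext <;> simp
    rw [this]
    rfl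
  refine ⟨AdjoinRoot M, inferInstance, AdjoinRoot.root M, fun q => ?_, fun q y _ _ _ => ?_⟩
  · rw [vanish_iff_dvd (ZMod p) hμ, he, AdjoinRoot.mk_eq_zero]
  · obtain ⟨g, rfl⟩ := AdjoinRoot.mk_surjective y
    obtain ⟨F, h1, h2, h3⟩ := exists_lift_zmod (g %ₘ M)
    refine ⟨F, 1, ⟨?_, fun i => (h3 i).trans hps⟩, inBox_one s, by simp, ?_⟩
    · have h4 := natDegree_modByMonic_le g hMm
      have h5 : M.natDegree ≤ s :=
        natDegree_map_le.trans ((natDegree_modulus μ).trans_le h.2.2.1)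
      omega
    · rw [map_one, mul_one, he, h1, ← sub_eq_zero, ← map_sub, AdjoinRoot.mk_eq_zero]
      rw [modByMonic_eq_sub_mul_div]
      exact ⟨-(g /ₘ M), by ring⟩

lemma PointCheck.goodPoint_numberField {s : ℕ} {μ : PolyCode} (h : PointCheck s 0 μ)
    (hμ : μ ≠ []) : GoodPoint s 0 μ := by
  have hsmall := h.smallPoly_modulus hμ
  have hirr : Irreducible (modulus μ) := by
    have := h.irreducible_modulus hμ ℤ fun f _ hf => by
      rw [Int.castRingHom_int, map_id] at hf
      exact ⟨f, by rw [Int.castRingHom_int, map_id], le_rfl,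
        (hsmall.inBox_of_dvd (modulus_monic μ).ne_zero hf).2⟩
    rwa [Int.castRingHom_int, map_id] at this
  rw [(modulus_monic μ).irreducible_iff_irreducible_map_fraction_map (K := ℚ)] at hirr
  set M := (modulus μ).map (algebraMap ℤ ℚ) with hM
  have hMm : M.Monic := (modulus_monic μ).map _
  have := Fact.mk hirr
  let pb := AdjoinRoot.powerBasis hirr.ne_zero
  have : FiniteDimensional ℚ (AdjoinRoot M) := pb.finite
  have hnf : NumberField (AdjoinRoot M) := ⟨⟩
  have hgen : pb.gen = AdjoinRoot.root M := rfl
  have he (q : ℤ[X]) : evalAt pb.gen q = aeval pb.gen q := rfl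
  have hroot : aeval pb.gen (modulus μ) = 0 := by
    have h1 : evalAt pb.gen = (AdjoinRoot.mk M).comp (mapRingHom (algebraMap ℤ ℚ)) := by
      ext <;> simp [hgen]
    rw [← he, h1]
    exact AdjoinRoot.mk_self
  have hint : IsIntegral ℤ pb.gen := ⟨modulus μ, modulus_monic μ, hroot⟩
  have hmin : minpoly ℤ pb.gen = modulus μ := by
    refine map_injective (algebraMap ℤ ℚ) (algebraMap ℤ ℚ).injective_int ?_
    rw [← minpoly.isIntegrallyClosed_eq_field_fractions' ℚ hint]
    exact (AdjoinRoot.minpoly_root hirr.ne_zero).trans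
      (by rw [hMm.leadingCoeff, inv_one, C_1, mul_one])
  refine ⟨AdjoinRoot M, inferInstance, pb.gen, fun q => ?_, fun q y h1 h2 h3 =>
    isBoxFraction_of_root_numberField pb hint (hmin ▸ hsmall) h1 h2 h3⟩
  rw [vanish_iff_dvd ℤ hμ, he, minpoly.isIntegrallyClosed_dvd_iff hint, hmin,
    Int.castRingHom_int, map_id, map_id]

lemma PointCheck.goodPoint {s p : ℕ} {μ : PolyCode} (h : PointCheck s p μ) : GoodPoint s p μ := by
  by_cases hμ : μ = []
  · subst hμ
    rcases h.1 with rfl | hp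
    · exact goodPoint_rat_nil s
    · exact goodPoint_zmod_nil hp h.2.1
  · rcases h.1 with rfl | hp
    · exact h.goodPoint_numberField hμ
    · exact h.goodPoint_zmod hμ hp

/-! ### Certificates of falsity -/

/-- The sentence is refuted by the point given by `p` and `μ`: there is no generic solution, and no
fraction with numerator `u` and denominator `v` from the box is a solution. -/
def Refutes (s p : ℕ) (μ : PolyCode) (Φ : DNFCode) : Prop :=
  (∀ c ∈ Φ, ∀ q ∈ c.2 :: c.1, ∀ l ∈ q, SmallCode s l) ∧
  (∀ c ∈ Φ, (∃ z ∈ c.1.flatten, ¬Vanish p μ z) ∨ ∀ g ∈ c.2, Vanish p μ g) ∧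
  ∀ u ∈ box (coeffBound s) (2 * s + 1), ∀ v ∈ box (coeffBound s) (2 * s + 1), Vanish p μ v ∨
    ∀ c ∈ Φ, (∃ q ∈ c.1, ¬Vanish p μ (homog q u v)) ∨ Vanish p μ (homog c.2 u v)

lemma PointCheck.not_solvable {s p : ℕ} {μ : PolyCode} {Φ : DNFCode} (h : PointCheck s p μ)
    (hr : Refutes s p μ Φ) : ∃ (k : Type) (_ : Field k) (a : k),
      (∀ q, Vanish p μ q ↔ evalAt a (val q) = 0) ∧
      ¬SolvableGen (Φ.map clauseVal) a ∧ ¬Solvable (Φ.map clauseVal) a := by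
  obtain ⟨k, _, a, ha, hbox⟩ := h.goodPoint
  have hgen (c) (hc : c ∈ Φ) : ¬(clauseVal c).HoldsGen a := by
    rw [holdsGen_clauseVal]
    rintro ⟨g, hg, h1, h2⟩
    rcases hr.2.1 c hc with ⟨z, hz, h3⟩ | h3
    · exact h3 ((ha z).2 (h1 z hz))
    · exact h2 ((ha g).1 (h3 g hg))
  refine ⟨k, _, a, ha, ?_, ?_⟩
  · rintro ⟨_, hc, h1⟩
    obtain ⟨c, hc', rfl⟩ := List.mem_map.1 hc
    exact hgen c hc' h1
  · rintro ⟨_, hc, y, h1⟩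
    obtain ⟨c, hc', rfl⟩ := List.mem_map.1 hc
    by_cases hy : IsBoxFraction s a y
    · obtain ⟨u, v, hu, hv, hv0, huv⟩ := hy
      obtain ⟨u, hu', rfl⟩ := hu.exists_mem_box
      obtain ⟨v, hv', rfl⟩ := hv.exists_mem_box
      rw [holds_clauseVal hv0 huv] at h1
      rcases hr.2.2 u hu' v hv' with h2 | h2
      · exact hv0 ((ha v).1 h2)
      · rcases h2 c hc' with ⟨q, hq, h3⟩ | h3
        · exact h3 ((ha _).2 (h1.1 q hq))
        · exact h1.2 ((ha _).1 h3)
    · -- a root of a nonzero polynomial would lie in the box, so all equations are trivial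
      refine hgen c hc' ⟨fun q hq => ?_, fun h0 => h1.2 ?_⟩
      · by_contra hq0
        refine hy (hbox q y ?_ hq0 (h1.1 q hq))
        obtain ⟨q, hq', rfl⟩ := List.mem_map.1 hq
        exact (forall_coeff_val (p := SmallPoly s) (by simp [SmallPoly])).2 fun l hl =>
          (hr.1 c hc' q (List.mem_cons_of_mem _ hq') l hl).smallPoly
      · rw [← eval_map, h0, eval_zero]

/-- A code for `c ^ E * f(x / c)`, where `f` is the given polynomial of degree at most `E`. -/
def scaleCode (c : ℕ × ℕ) (E : ℕ) (l : PolyCode) : PolyCode :=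
  (List.range l.length).map fun i => mul (l.getD i zero) (pow c (E - i))

/-- The substitution of `x / c` for `x`. -/
def scaleDNF (c : ℕ × ℕ) (E : ℕ) (Φ : DNFCode) : DNFCode :=
  Φ.map fun d => (d.1.map (List.map (scaleCode c E)), d.2.map (scaleCode c E))

lemma evalAt_scaleCode {K : Type*} [Field K] {c : ℕ × ℕ} {E : ℕ} {l : PolyCode}
    (hl : l.length ≤ E) (a : K) : evalAt (((val c : ℤ) : K) * a) (val (scaleCode c E l)) =
      ((val c : ℤ) : K) ^ E * evalAt a (val l) := by
  have hdeg (r : PolyCode) (hr : r.length ≤ E) : (val r).natDegree < E + 1 :=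
    Nat.lt_succ_of_le
      (natDegree_le_of_degree_le ((degree_val_lt r).le.trans (by exact_mod_cast hr)))
  rw [coe_eval₂RingHom, coe_eval₂RingHom, eval₂_eq_sum_range' _ (hdeg l hl),
    eval₂_eq_sum_range' _ (hdeg _ (by simpa [scaleCode] using hl)), Finset.mul_sum]
  refine Finset.sum_congr rfl fun i hi => ?_
  rw [coeff_val, coeff_val, scaleCode, getD_map_range]
  split_ifs with h
  · rw [val_mul, val_pow, mul_pow, ← pow_sub_mul_pow _ (Nat.lt_succ_iff.1 (Finset.mem_range.1 hi))]
    simp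
    ring
  · rw [List.getD_eq_default _ _ (by omega)]
    simp

section Scale

variable {K : Type*} [Field K] {c : ℕ × ℕ} {E : ℕ} {Φ : DNFCode} {a : K}

lemma map_scaleCode {q : PolyCode₂} (hq : ∀ l ∈ q, l.length ≤ E) :
    (val (q.map (scaleCode c E))).map (evalAt (((val c : ℤ) : K) * a)) =
      C (((val c : ℤ) : K) ^ E) * (val q).map (evalAt a) := by
  ext j
  rw [coeff_C_mul, coeff_map, coeff_map, coeff_val, coeff_val]
  by_cases hj : j < q.length
  · rw [List.getD_eq_getElem _ _ (by simpa using hj), List.getD_eq_getElem _ _ hj,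
      List.getElem_map, evalAt_scaleCode (hq _ (List.getElem_mem hj))]
  · rw [List.getD_eq_default _ _ (by simpa using hj), List.getD_eq_default _ _ (by omega)]
    simp

lemma solvableGen_scaleDNF (hc : ((val c : ℤ) : K) ≠ 0)
    (hΦ : ∀ d ∈ Φ, ∀ q ∈ d.2 :: d.1, ∀ l ∈ q, l.length ≤ E) :
    SolvableGen ((scaleDNF c E Φ).map clauseVal) (((val c : ℤ) : K) * a) ↔
      SolvableGen (Φ.map clauseVal) a := by
  simp only [SolvableGen, scaleDNF, List.map_map, List.mem_map, Function.comp_apply,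
    exists_exists_and_eq_and]
  refine exists_congr fun d => and_congr_right fun hd => ?_
  have h := hΦ d hd
  have hcE : C (((val c : ℤ) : K) ^ E) ≠ 0 := C_ne_zero.2 (pow_ne_zero _ hc)
  simp only [Clause.HoldsGen, clauseVal, List.mem_map, forall_exists_index, and_imp,
    forall_apply_eq_imp_iff₂, map_scaleCode (h d.2 List.mem_cons_self), mul_ne_zero_iff]
  refine and_congr (forall₂_congr fun q hq => ?_) (and_iff_right hcE)
  rw [map_scaleCode (h q (List.mem_cons_of_mem _ hq)), mul_eq_zero, or_iff_right hcE]

lemma solvable_scaleDNF (hc : ((val c : ℤ) : K) ≠ 0)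
    (hΦ : ∀ d ∈ Φ, ∀ q ∈ d.2 :: d.1, ∀ l ∈ q, l.length ≤ E) :
    Solvable ((scaleDNF c E Φ).map clauseVal) (((val c : ℤ) : K) * a) ↔
      Solvable (Φ.map clauseVal) a := by
  simp only [Solvable, scaleDNF, List.map_map, List.mem_map, Function.comp_apply,
    exists_exists_and_eq_and]
  refine exists_congr fun d => and_congr_right fun hd => exists_congr fun y => ?_
  have h := hΦ d hd
  have key (q) (hq : q ∈ d.2 :: d.1) :
      (val (q.map (scaleCode c E))).eval₂ (evalAt (((val c : ℤ) : K) * a)) y =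
        ((val c : ℤ) : K) ^ E * (val q).eval₂ (evalAt a) y := by
    rw [← eval_map, map_scaleCode (h q hq), eval_mul, eval_C, eval_map]
  simp only [Clause.Holds, clauseVal, List.mem_map, forall_exists_index, and_imp,
    forall_apply_eq_imp_iff₂, key d.2 List.mem_cons_self]
  refine and_congr (forall₂_congr fun q hq => ?_) (by simp [hc])
  rw [key q (List.mem_cons_of_mem _ hq), mul_eq_zero]
  simp [hc]

end Scale

/-- Certificates for the falsity of a sentence in some infinite field. Such a certificate
`((c, E), (s, p), μ)` says that `x = α / c` is a counterexample, where `α` is the point given by `p`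
and `μ`; the number `E` bounds the degrees that matter for clearing the denominator `c`, and `s` is
the bound for the complexity. -/
def FalseCert (Φ : DNFCode) (t : ((ℕ × ℕ) × ℕ) × (ℕ × ℕ) × PolyCode) : Prop :=
  (∀ d ∈ Φ, ∀ q ∈ d.2 :: d.1, ∀ l ∈ q, l.length ≤ t.1.2) ∧ ¬Vanish t.2.1.2 t.2.2 [t.1.1] ∧
    PointCheck t.2.1.1 t.2.1.2 t.2.2 ∧ Refutes t.2.1.1 t.2.1.2 t.2.2 (scaleDNF t.1.1 t.1.2 Φ)

lemma FalseCert.not_trueInInfinite {Φ : DNFCode} {t : ((ℕ × ℕ) × ℕ) × (ℕ × ℕ) × PolyCode}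
    (h : FalseCert Φ t) : ¬TrueInInfinite.{u} (Φ.map clauseVal) := by
  obtain ⟨⟨c, E⟩, ⟨s, p⟩, μ⟩ := t
  obtain ⟨hE, hc, hp, hr⟩ := h
  obtain ⟨k, _, b, hb, h1, h2⟩ := hp.not_solvable hr
  have hc0 : ((val c : ℤ) : k) ≠ 0 := by
    simpa [hb, val_cons, val_nil] using hc
  intro h
  rw [← mul_div_cancel₀ b hc0] at h1 h2
  rw [solvableGen_scaleDNF hc0 hE] at h1
  rw [solvable_scaleDNF hc0 hE] at h2
  exact (h.solvableGen_or_solvable _).elim h1 h2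

/-- Every point of a field, up to multiplication by a nonzero integer, is given by some `p`
and `μ`. -/
lemma exists_vanish_iff {A K : Type*} [CommRing A] [IsDomain A] [IsIntegrallyClosed A] {p : ℕ}
    [CharP A p] (hA : Function.Surjective (Int.cast : ℤ → A)) [Field K] [Algebra A K]
    [FaithfulSMul A K] [Module.IsTorsionFree A K] (a : K) :
    ∃ c : ℕ × ℕ, ((val c : ℤ) : K) ≠ 0 ∧
      ∃ μ, ∀ q, Vanish p μ q ↔ evalAt (((val c : ℤ) : K) * a) (val q) = 0 := by
  have he (b : K) (q : ℤ[X]) : evalAt b q = aeval b (q.map (Int.castRingHom A)) := by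
    rw [aeval_def, eval₂_map, coe_eval₂RingHom]
    congr 1
    exact RingHom.ext_int _ _
  by_cases ha : IsAlgebraic A a
  · obtain ⟨y, hy0, hy⟩ := ha.exists_integral_multiple
    obtain ⟨z, rfl⟩ := hA y
    obtain ⟨c, rfl⟩ := val_int_surjective z
    have h1 : ((val c : ℤ) : A) • a = ((val c : ℤ) : K) * a := by
      rw [Algebra.smul_def, map_intCast]
    rw [h1] at hy
    refine ⟨c, fun h0 => hy0 ?_, ?_⟩
    · rw [← map_intCast (algebraMap A K)] at h0
      exact (map_eq_zero_iff _ (FaithfulSMul.algebraMap_injective A K)).1 h0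
    · set b := ((val c : ℤ) : K) * a
      choose g hg using hA
      choose e he' using val_int_surjective
      set m := minpoly A b
      let μ : PolyCode := (List.range m.natDegree).map fun i => e (g (m.coeff i))
      have hlen : μ.length = m.natDegree := by simp [μ]
      have hm : m.Monic := minpoly.monic hy
      have hμ : (modulus μ).map (Int.castRingHom A) = m := by
        ext i
        rw [coeff_map, modulus, coeff_add, coeff_X_pow, coeff_val, getD_map_range, hlen]
        rcases lt_trichotomy i m.natDegree with h | rfl | h
        · simp [h, h.ne, he', hg]
        · simp [hm]
        · simp [h.ne', h.not_gt, coeff_eq_zero_of_natDegree_lt h]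
      refine ⟨μ, fun q => ?_⟩
      rw [vanish_iff_dvd A, hμ, he, minpoly.isIntegrallyClosed_dvd_iff hy]
      rw [← List.length_pos_iff, hlen]
      exact minpoly.natDegree_pos hy
  · refine ⟨one, by simp, [], fun q => ?_⟩
    rw [vanish_nil_iff A, he]
    simp only [val_one, Int.cast_one, one_mul]
    exact ⟨fun h => by rw [h, map_zero], transcendental_iff.1 ha _⟩

lemma eventually_forall_mem {α : Type*} {l : List α} {P : α → ℕ → Prop}
    (h : ∀ x ∈ l, ∀ᶠ s in Filter.atTop, P x s) : ∀ᶠ s in Filter.atTop, ∀ x ∈ l, P x s := by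
  induction l with
  | nil => simp
  | cons x l ih =>
    simp only [List.forall_mem_cons, Filter.eventually_and] at h ⊢
    exact ⟨h.1, ih h.2⟩

lemma eventually_smallCode (l : PolyCode) : ∀ᶠ s in Filter.atTop, SmallCode s l :=
  (Filter.eventually_ge_atTop _).and (eventually_forall_mem fun _ _ =>
    (Filter.eventually_ge_atTop _).and (Filter.eventually_ge_atTop _))

/-- False sentences have certificates: for a counterexample in an infinite field, all conditions on
a certificate are true statements about this field. -/
lemma exists_falseCert {Φ : DNFCode} (h : ¬TrueInInfinite.{u} (Φ.map clauseVal)) :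
    ∃ t, FalseCert Φ t := by
  simp only [TrueInInfinite, not_forall] at h
  obtain ⟨K, _, _, a, ha⟩ := h
  obtain ⟨p, hK⟩ := CharP.exists K
  have hp : p = 0 ∨ p.Prime := (CharP.char_is_prime_or_zero K p).symm
  obtain ⟨c, hc, μ, hμ⟩ : ∃ c : ℕ × ℕ, ((val c : ℤ) : K) ≠ 0 ∧
      ∃ μ, ∀ q, Vanish p μ q ↔ evalAt (((val c : ℤ) : K) * a) (val q) = 0 := by
    rcases hp with rfl | hp
    · have := CharP.charP_to_charZero K
      exact exists_vanish_iff (A := ℤ) (fun z => ⟨z, rfl⟩) a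
    · have := Fact.mk hp
      let := ZMod.algebra K p
      exact exists_vanish_iff (A := ZMod p) ZMod.intCast_surjective a
  obtain ⟨E, hE⟩ : ∃ E, ∀ d ∈ Φ, ∀ q ∈ d.2 :: d.1, ∀ l ∈ q, l.length ≤ E :=
    (eventually_forall_mem fun d _ => eventually_forall_mem fun q _ =>
      eventually_forall_mem fun l _ => Filter.eventually_ge_atTop l.length).exists
  rw [← solvable_scaleDNF hc hE] at ha
  set Ψ := scaleDNF c E Φ
  set b := ((val c : ℤ) : K) * a
  obtain ⟨s, hs1, hs2, hs3⟩ : ∃ s, (∀ d ∈ Ψ, ∀ q ∈ d.2 :: d.1, ∀ l ∈ q, SmallCode s l) ∧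
      p ≤ s ∧ SmallCode s μ :=
    ((eventually_forall_mem fun d _ => eventually_forall_mem fun q _ =>
      eventually_forall_mem fun l _ => eventually_smallCode l).and
      ((Filter.eventually_ge_atTop p).and (eventually_smallCode μ))).exists
  refine ⟨((c, E), (s, p), μ), hE, ?_, ⟨hp, hs2, hs3.1, hs3.2, fun u _ w _ => ?_⟩, hs1,
    fun d hd => ?_, fun u _ v _ => ?_⟩
  · simpa [hμ, val_cons, val_nil] using hc
  · simp only [hμ, val_mul, map_mul, mul_eq_zero, imp_self]
  · have h1 : ¬(clauseVal d).HoldsGen b := fun h0 =>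
      ha (SolvableGen.solvable ⟨_, List.mem_map_of_mem hd, h0⟩)
    rw [holdsGen_clauseVal] at h1
    simp only [hμ]
    push Not at h1
    by_cases h2 : ∃ z ∈ d.1.flatten, ¬evalAt b (val z) = 0
    · exact .inl h2
    · push Not at h2
      exact .inr fun g hg => h1 g hg h2
  · simp only [hμ]
    refine or_iff_not_imp_left.2 fun hv d hd => ?_
    have h1 := mt (holds_clauseVal hv (div_mul_cancel₀ (evalAt b (val u)) hv).symm).2
      fun h0 => ha ⟨_, List.mem_map_of_mem hd, _, h0⟩
    by_contra! h2
    exact h1 h2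

/-! ### The decision procedure -/

section Bounded

variable {α β : Type} [Primcodable α] [Primcodable β]

lemma primrecPred_forall_mem {f : α → List β} {R : α → β → Prop} (hf : Primrec f)
    (hR : PrimrecPred fun x : α × β => R x.1 x.2) : PrimrecPred fun x => ∀ b ∈ f x, R x b :=
  PrimrecRel.comp (PrimrecRel.forall_mem_list (R := fun b x => R x b)
    (hR.comp (Primrec.pair .snd .fst))) hf .id

lemma primrecPred_exists_mem {f : α → List β} {R : α → β → Prop} (hf : Primrec f)
    (hR : PrimrecPred fun x : α × β => R x.1 x.2) : PrimrecPred fun x => ∃ b ∈ f x, R x b :=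
  PrimrecRel.comp (PrimrecRel.exists_mem_list (R := fun b x => R x b)
    (hR.comp (Primrec.pair .snd .fst))) hf .id

/-- Search for a certificate. -/
lemma rePred_exists {R : α → β → Prop} (hR : PrimrecPred fun x : α × β => R x.1 x.2) :
    REPred fun a => ∃ b, R a b := by
  obtain ⟨i, hR⟩ := hR
  let d (a : α) (b : β) : Bool := @decide _ (i (a, b))
  have hd (a : α) (b : β) : d a b = true ↔ R a b := @decide_eq_true_iff _ (i (a, b))
  have hd' : Primrec fun x : (α × ℕ) × β => d x.1.1 x.2 :=
    hR.comp (Primrec.pair (Primrec.fst.comp .fst) .snd)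
  have hp : Primrec₂ fun (a : α) (n : ℕ) =>
      ((Encodable.decode n : Option β).map (d a)).getD false :=
    Primrec.option_getD.comp (Primrec.option_map (Primrec.decode.comp .snd) hd') (.const false)
  refine (Partrec.rfind (p := fun a n => Part.some _) hp.to_comp.partrec₂).dom_re.of_eq
    fun a => Nat.rfind_dom.trans ⟨?_, ?_⟩
  · rintro ⟨n, hn, -⟩
    rw [Part.mem_some_iff] at hn
    cases h : (Encodable.decode n : Option β) with
    | none => simp [h] at hn
    | some b => exact ⟨b, (hd a b).1 (by simpa [h] using hn.symm)⟩
  · rintro ⟨b, hb⟩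
    exact ⟨Encodable.encode b, by simpa using (hd a b).2 hb, fun _ => trivial⟩

end Bounded

lemma primrecPred_prime : PrimrecPred Nat.Prime := by
  have h : PrimrecPred fun x : ℕ × ℕ => x.2 ∣ x.1 → x.2 = 1 := by
    refine ((PrimrecPred.not (Primrec.eq.comp (Primrec.nat_mod.comp .fst .snd) (.const 0))).or
      (Primrec.eq.comp .snd (.const 1))).of_eq fun x => ?_
    rw [Nat.dvd_iff_mod_eq_zero, imp_iff_not_or]
  refine ((Primrec.nat_le.comp (.const 2) .id).and
    (primrecPred_forall_mem (R := fun p m => m ∣ p → m = 1) Primrec.list_range h)).of_eq fun p => ?_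
  rw [Nat.prime_def_lt]
  simp

lemma primrec_homog_comp {α : Type} [Primcodable α] {q : α → PolyCode₂} {u v : α → PolyCode}
    (hq : Primrec q) (hu : Primrec u) (hv : Primrec v) :
    Primrec fun x => homog (q x) (u x) (v x) :=
  primrec_homog.comp (Primrec.pair hq (Primrec.pair hu hv))

lemma primrecPred_trueCert : PrimrecPred fun x : DNFCode ×
    (List (PolyCode × PolyCode) × List (ℕ × List PolyCode)) => TrueCert x.1 x.2 := by
  have h1 : Primrec fun x : DNFCode × List (PolyCode × PolyCode) => insts x.1 x.2 := by
    refine Primrec.list_flatMap .fst (Primrec.list_append.comp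
      (Primrec.list_map (Primrec.snd.comp .snd) ?_) (Primrec.list_map (Primrec.snd.comp .fst) ?_))
    · exact Primrec.pair (Primrec.list_flatten.comp (Primrec.fst.comp (Primrec.snd.comp .fst))) .snd
    · have hu : Primrec fun x : ((DNFCode × List (PolyCode × PolyCode)) ×
          (List PolyCode₂ × PolyCode₂)) × (PolyCode × PolyCode) => x.2.1 := Primrec.fst.comp .snd
      have hv : Primrec fun x : ((DNFCode × List (PolyCode × PolyCode)) ×
          (List PolyCode₂ × PolyCode₂)) × (PolyCode × PolyCode) => x.2.2 := Primrec.snd.comp .snd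
      refine Primrec.pair (Primrec.list_map (Primrec.fst.comp (Primrec.snd.comp .fst)) ?_)
        (primrec_mul.comp hv (primrec_homog_comp (Primrec.snd.comp (Primrec.snd.comp .fst)) hu hv))
      exact primrec_homog_comp .snd (hu.comp .fst) (hv.comp .fst)
  refine primrecPred_forall_mem
    (primrec_codeBranches.comp (h1.comp (Primrec.pair .fst (Primrec.fst.comp .snd))))
    (primrecPred_exists_mem (Primrec.snd.comp (Primrec.snd.comp .fst))
      (primrecPred_forall_mem ?_ ?_))
  · refine primrec_add.comp (primrec_pow.comp ?_ ?_)
      (primrec_neg.comp (primrec_comb.comp ?_ ?_))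
    · exact Primrec.fst.comp (Primrec.snd.comp .fst)
    · exact Primrec.fst.comp .snd
    · exact Primrec.snd.comp .snd
    · exact Primrec.snd.comp (Primrec.snd.comp .fst)
  · exact Primrec.eq.comp (Primrec.fst.comp .snd) (Primrec.snd.comp .snd)

lemma primrec_remCode : Primrec₂ remCode := by
  have h : Primrec fun x : PolyCode × (ℕ × ℕ) × PolyCode => remStep x.1 x.2.1 x.2.2 := by
    have hl : Primrec fun x : (PolyCode × (ℕ × ℕ) × PolyCode) × ℕ => x.1.2.1 :: x.1.2.2 :=
      Primrec.list_cons.comp (Primrec.fst.comp (Primrec.snd.comp .fst))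
        (Primrec.snd.comp (Primrec.snd.comp .fst))
    have hμ : Primrec fun x : (PolyCode × (ℕ × ℕ) × PolyCode) × ℕ => x.1.1 :=
      Primrec.fst.comp .fst
    refine Primrec.list_map (Primrec.list_range.comp (Primrec.list_length.comp .fst))
      (primrec_add.comp ((Primrec.list_getD _).comp hl .snd) (primrec_neg.comp (primrec_mul.comp
        ((Primrec.list_getD _).comp hl (Primrec.list_length.comp hμ))
        ((Primrec.list_getD _).comp hμ .snd))))
  refine Primrec.ite (Primrec.eq.comp .fst (.const [])) .snd ?_
  exact Primrec.list_foldr (f := fun x : PolyCode × PolyCode => x.2) (g := fun _ => [])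
    (h := fun x y => remStep x.1 y.1 y.2) .snd (.const [])
    (h.comp (Primrec.pair (Primrec.fst.comp .fst) .snd))

lemma PrimrecPred.vanish {α : Type} [Primcodable α] {p : α → ℕ} {μ q : α → PolyCode}
    (hp : Primrec p) (hμ : Primrec μ) (hq : Primrec q) :
    PrimrecPred fun x => Vanish (p x) (μ x) (q x) := by
  refine primrecPred_forall_mem (primrec_remCode.comp hμ hq) (Primrec.eq.comp ?_ ?_)
  · exact Primrec.nat_mod.comp (Primrec.fst.comp .snd) (hp.comp .fst)
  · exact Primrec.nat_mod.comp (Primrec.snd.comp .snd) (hp.comp .fst)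

lemma primrec_coeffBound : Primrec coeffBound := by
  have h : Primrec₂ ((· ^ ·) : ℕ → ℕ → ℕ) := Primrec₂.unpaired'.1 Nat.Primrec.pow
  exact h.comp (Primrec.nat_mul.comp (.const 2) .succ) (Primrec.nat_add.comp .id (.const 5))

lemma primrec_box : Primrec₂ box := by
  have hd : Primrec digits := by
    refine Primrec.list_flatMap (Primrec.list_range.comp .succ) ?_
    exact Primrec.list_cons.comp (Primrec.pair .snd (.const 0))
      (Primrec.list_cons.comp (Primrec.pair (.const 0) .snd) (.const []))
  refine Primrec.nat_rec (f := fun _ => [ [] ])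
    (g := fun H x => (digits H).flatMap fun c => x.2.map (List.cons c)) (.const _) ?_
  refine Primrec.list_flatMap (hd.comp .fst) (Primrec.list_map (Primrec.snd.comp
    (Primrec.snd.comp .fst)) ?_)
  exact Primrec.list_cons.comp (Primrec.snd.comp .fst) .snd

lemma primrecPred_smallDigits : PrimrecPred fun x : ℕ × PolyCode =>
    ∀ c ∈ x.2, c.1 ≤ x.1 ∧ c.2 ≤ x.1 :=
  primrecPred_forall_mem .snd
    ((Primrec.nat_le.comp (Primrec.fst.comp .snd) (Primrec.fst.comp .fst)).and
      (Primrec.nat_le.comp (Primrec.snd.comp .snd) (Primrec.fst.comp .fst)))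

lemma primrecPred_smallCode : PrimrecPred fun x : ℕ × PolyCode => SmallCode x.1 x.2 :=
  (Primrec.nat_le.comp (Primrec.list_length.comp .snd) .fst).and primrecPred_smallDigits

lemma primrecPred_pointCheck :
    PrimrecPred fun x : (ℕ × ℕ) × PolyCode => PointCheck x.1.1 x.1.2 x.2 := by
  have hs : Primrec fun x : (ℕ × ℕ) × PolyCode => x.1.1 := Primrec.fst.comp .fst
  have hp : Primrec fun x : (ℕ × ℕ) × PolyCode => x.1.2 := Primrec.snd.comp .fst
  have hb : Primrec fun x : (ℕ × ℕ) × PolyCode => box (coeffBound x.1.1) x.2.length :=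
    primrec_box.comp (primrec_coeffBound.comp hs) (Primrec.list_length.comp .snd)
  refine ((Primrec.eq.comp hp (.const 0)).or (primrecPred_prime.comp hp)).and
    ((Primrec.nat_le.comp hp hs).and
    ((Primrec.nat_le.comp (Primrec.list_length.comp .snd) hs).and
    ((primrecPred_smallDigits.comp (Primrec.pair hs .snd)).and
    (primrecPred_forall_mem hb (primrecPred_forall_mem (hb.comp .fst) ?_)))))
  have hx : Primrec fun x : (((ℕ × ℕ) × PolyCode) × PolyCode) × PolyCode => x.1.1 :=
    Primrec.fst.comp .fst
  have hu : Primrec fun x : (((ℕ × ℕ) × PolyCode) × PolyCode) × PolyCode => x.1.2 :=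
    Primrec.snd.comp .fst
  have hv {q : (((ℕ × ℕ) × PolyCode) × PolyCode) × PolyCode → PolyCode} (hq : Primrec q) :
      PrimrecPred fun x => Vanish x.1.1.1.2 x.1.1.2 (q x) :=
    PrimrecPred.vanish (hp.comp hx) (Primrec.snd.comp hx) hq
  exact ((hv (primrec_mul.comp hu .snd)).not.or ((hv hu).or (hv .snd))).of_eq fun x =>
    imp_iff_not_or.symm

lemma primrecPred_refutes :
    PrimrecPred fun x : ((ℕ × ℕ) × PolyCode) × DNFCode => Refutes x.1.1.1 x.1.1.2 x.1.2 x.2 := by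
  have hs : Primrec fun x : ((ℕ × ℕ) × PolyCode) × DNFCode => x.1.1.1 :=
    Primrec.fst.comp (Primrec.fst.comp .fst)
  have hp : Primrec fun x : ((ℕ × ℕ) × PolyCode) × DNFCode => x.1.1.2 :=
    Primrec.snd.comp (Primrec.fst.comp .fst)
  have hμ : Primrec fun x : ((ℕ × ℕ) × PolyCode) × DNFCode => x.1.2 := Primrec.snd.comp .fst
  have hb : Primrec fun x : ((ℕ × ℕ) × PolyCode) × DNFCode =>
      box (coeffBound x.1.1.1) (2 * x.1.1.1 + 1) :=
    primrec_box.comp (primrec_coeffBound.comp hs)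
      (Primrec.succ.comp (Primrec.nat_mul.comp (.const 2) hs))
  have hv {α : Type} [Primcodable α] {f : α → ((ℕ × ℕ) × PolyCode) × DNFCode} {q : α → PolyCode}
      (hf : Primrec f) (hq : Primrec q) :
      PrimrecPred fun x => Vanish (f x).1.1.2 (f x).1.2 (q x) :=
    PrimrecPred.vanish (hp.comp hf) (hμ.comp hf) hq
  refine (primrecPred_forall_mem .snd (primrecPred_forall_mem
      (Primrec.list_cons.comp (Primrec.snd.comp .snd) (Primrec.fst.comp .snd))
      (primrecPred_forall_mem .snd (primrecPred_smallCode.comp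
        (Primrec.pair (hs.comp (Primrec.fst.comp (Primrec.fst.comp .fst))) .snd))))).and
    ((primrecPred_forall_mem .snd ((primrecPred_exists_mem
      (Primrec.list_flatten.comp (Primrec.fst.comp .snd)) (hv (Primrec.fst.comp .fst) .snd).not).or
      (primrecPred_forall_mem (Primrec.snd.comp .snd) (hv (Primrec.fst.comp .fst) .snd)))).and
    (primrecPred_forall_mem hb (primrecPred_forall_mem (hb.comp .fst)
      ((hv (Primrec.fst.comp .fst) .snd).or (primrecPred_forall_mem
        (Primrec.snd.comp (Primrec.fst.comp .fst)) ?_)))))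
  have hu : Primrec fun x : (((((ℕ × ℕ) × PolyCode) × DNFCode) × PolyCode) × PolyCode) ×
      (List PolyCode₂ × PolyCode₂) => x.1.1.2 := Primrec.snd.comp (Primrec.fst.comp .fst)
  have hw : Primrec fun x : (((((ℕ × ℕ) × PolyCode) × DNFCode) × PolyCode) × PolyCode) ×
      (List PolyCode₂ × PolyCode₂) => x.1.2 := Primrec.snd.comp .fst
  have hx : Primrec fun x : (((((ℕ × ℕ) × PolyCode) × DNFCode) × PolyCode) × PolyCode) ×
      (List PolyCode₂ × PolyCode₂) => x.1.1.1 := Primrec.fst.comp (Primrec.fst.comp .fst)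
  refine (primrecPred_exists_mem (Primrec.fst.comp .snd) (hv (hx.comp .fst) ?_).not).or (hv hx ?_)
  · exact primrec_homog_comp .snd (hu.comp .fst) (hw.comp .fst)
  · exact primrec_homog_comp (Primrec.snd.comp .snd) hu hw

lemma primrec_scaleDNF :
    Primrec fun x : ((ℕ × ℕ) × ℕ) × DNFCode => scaleDNF x.1.1 x.1.2 x.2 := by
  have hs : Primrec fun x : ((ℕ × ℕ) × ℕ) × PolyCode => scaleCode x.1.1 x.1.2 x.2 := by
    refine Primrec.list_map (Primrec.list_range.comp (Primrec.list_length.comp .snd))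
      (primrec_mul.comp ((Primrec.list_getD _).comp (Primrec.snd.comp .fst) .snd)
        (primrec_pow.comp ?_ (Primrec.nat_sub.comp ?_ .snd)))
    · exact Primrec.fst.comp (Primrec.fst.comp .fst)
    · exact Primrec.snd.comp (Primrec.fst.comp .fst)
  have hs' {α : Type} [Primcodable α] {f : α → (ℕ × ℕ) × ℕ} {l : α → PolyCode} (hf : Primrec f)
      (hl : Primrec l) : Primrec fun x => scaleCode (f x).1 (f x).2 (l x) :=
    hs.comp (Primrec.pair hf hl)
  refine Primrec.list_map .snd (Primrec.pair (Primrec.list_map (Primrec.fst.comp .snd)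
    (Primrec.list_map .snd ?_)) (Primrec.list_map (Primrec.snd.comp .snd) ?_))
  · exact hs' (Primrec.fst.comp (Primrec.fst.comp (Primrec.fst.comp .fst))) .snd
  · exact hs' (Primrec.fst.comp (Primrec.fst.comp .fst)) .snd

lemma primrecPred_falseCert : PrimrecPred fun x : DNFCode × ((ℕ × ℕ) × ℕ) × (ℕ × ℕ) × PolyCode =>
    FalseCert x.1 x.2 := by
  have hs : Primrec fun x : DNFCode × ((ℕ × ℕ) × ℕ) × (ℕ × ℕ) × PolyCode => x.2.1 :=
    Primrec.fst.comp .snd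
  have hp : Primrec fun x : DNFCode × ((ℕ × ℕ) × ℕ) × (ℕ × ℕ) × PolyCode => x.2.2 :=
    Primrec.snd.comp .snd
  refine (primrecPred_forall_mem .fst (primrecPred_forall_mem
      (Primrec.list_cons.comp (Primrec.snd.comp .snd) (Primrec.fst.comp .snd))
      (primrecPred_forall_mem .snd (Primrec.nat_le.comp (Primrec.list_length.comp .snd) ?_)))).and
    ((PrimrecPred.vanish (Primrec.snd.comp (Primrec.fst.comp hp)) (Primrec.snd.comp hp)
      (Primrec.list_cons.comp (Primrec.fst.comp hs) (.const []))).not.and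
    ((primrecPred_pointCheck.comp hp).and
    (primrecPred_refutes.comp (Primrec.pair hp (primrec_scaleDNF.comp (Primrec.pair hs .fst))))))
  exact Primrec.snd.comp (hs.comp (Primrec.fst.comp (Primrec.fst.comp .fst)))

lemma rePred_trueCert {D : ℕ → Option DNFCode} (hD : Primrec D) : REPred fun k =>
    ∃ t, ¬D k = none ∧ TrueCert ((D k).getD []) t := by
  have hD' : Primrec fun k => (D k).getD [] :=
    Primrec.option_getD.comp hD (.const [])
  have hN : PrimrecPred fun k => D k = none :=
    Primrec.eq.comp hD (.const none)
  exact rePred_exists (R := fun k t => ¬D k = none ∧ TrueCert ((D k).getD []) t)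
    ((hN.comp .fst).not.and (primrecPred_trueCert.comp (Primrec.pair (hD'.comp .fst) .snd)))

lemma rePred_falseCert {D : ℕ → Option DNFCode} (hD : Primrec D) : REPred fun k =>
    ∃ t, D k = none ∨ FalseCert ((D k).getD []) t := by
  have hD' : Primrec fun k => (D k).getD [] :=
    Primrec.option_getD.comp hD (.const [])
  have hN : PrimrecPred fun k => D k = none :=
    Primrec.eq.comp hD (.const none)
  exact rePred_exists (R := fun k t => D k = none ∨ FalseCert ((D k).getD []) t)
    ((hN.comp .fst).or (primrecPred_falseCert.comp (Primrec.pair (hD'.comp .fst) .snd)))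

/-- Truth in all infinite fields is decidable, since both truth and falsity have certificates. -/
theorem forallExistsDecidable_infinite :
    ForallExistsDecidable (forallExistsTheory.{u} fun K _ => Infinite K) := by
  refine ComputablePred.computable_iff_re_compl_re'.2
    ⟨(rePred_trueCert primrec_sentenceDNF).of_eq fun k => ?_,
    (rePred_falseCert primrec_sentenceDNF).of_eq fun k => ?_⟩
  · rw [mem_forallExistsTheory_iff]
    cases sentenceDNF k with
    | none => simp
    | some Φ =>
      simp only [reduceCtorEq, not_false_eq_true, true_and, Option.getD_some, Option.some.injEq,
        exists_eq_left']
      exact ⟨fun ⟨t, ht⟩ => ht.trueInInfinite, fun h => h.exists_trueCert⟩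
  · rw [mem_forallExistsTheory_iff]
    cases sentenceDNF k with
    | none => simp
    | some Φ =>
      simp only [reduceCtorEq, false_or, Option.getD_some, Option.some.injEq, exists_eq_left']
      exact ⟨fun ⟨t, ht⟩ => ht.not_trueInInfinite, fun h => exists_falseCert h⟩

end HilbertianDecidability

theorem mainTheorem4 :
    HilbertianDecidability.ForallExistsDecidable
        (HilbertianDecidability.forallExistsTheory.{u}
          fun K _ => HilbertianDecidability.IsHilbertian K) ∧
      HilbertianDecidability.forallExistsTheory.{u}
          (fun K _ => HilbertianDecidability.IsHilbertian K) =
        HilbertianDecidability.forallExistsTheory.{u} (fun K _ => Infinite K) := by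
  rw [HilbertianDecidability.forallExistsTheory_isHilbertian]
  exact ⟨HilbertianDecidability.forallExistsDecidable_infinite, rfl⟩
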